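/- Notation. Let $d\in\mathbb N=\{1,2,\dots\}$, $\alpha>0$, and let $\gamma=\{\gamma_{\mathfrak u}\}$ be positive weights indexed by the finite sets $\mathfrak u\subset\mathbb N$. For $h\in\mathbb Z^d$ put $\operatorname{supp}(h)=\{j: h_j\ne0\}$ and $r_{\alpha,\gamma}(h)=\gamma_{\operatorname{supp}(h)}^{-1}\prod_{j\in\operatorname{supp}(h)}|h_j|^{\alpha}$. The Korobov space $H_{d,\alpha,\gamma}$ consists of the $f\in L_2([0,1]^d)$ with $\|f\|^2:=\sum_{h\in\mathbb Z^d}|\hat f(h)|^2\,r_{\alpha,\gamma}(h)^2<\infty$, where $\hat f(h)=\int_{[0,1]^d}f(x)e^{-2\pi i h\cdot x}\,dx$. For $n\in\mathbb N$ let $P_n$ be the set of primes $p$ with $n/2<p\le n$ and $N=\prod_{p\in P_n}p$. For $z\in\mathbb Z^d$ consider the randomised algorithm $$Q_{n,z}(f)=\frac1p\sum_{k=0}^{p-1}f\Big(\Big(\frac{kz}{p}+\Delta\Big)\bmod 1\Big),$$ with $p$ uniformly distributed on $P_n$ and, independently, $\Delta$ uniformly distributed on $[0,1)^d$; its worst-case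 root mean square error is $$e_{d,n}(z)=\sup_{f\in H_{d,\alpha,\gamma},\ \|f\|\le1}\Big(\mathbb E\,\Big|Q_{n,z}(f)-\int_{[0,1]^d}f\Big|^2\Big)^{1/2}.$$ For $0<\lambda<\alpha$ put $\mu_d(\lambda)=\sum_{h\in\mathbb Z^d\setminus\{0\}}r_{\alpha,\gamma}(h)^{-1/\lambda}$ (which is finite), let $M(\lambda)=\sum_{\emptyset\ne\mathfrak u\subset\mathbb N,\,|\mathfrak u|<\infty}\gamma_{\mathfrak u}^{1/\lambda}(2\zeta(\alpha/\lambda))^{|\mathfrak u|}\in(0,\infty]$, and for $C>0$, $r\in\mathbb N$, $m\ge0$ put, with $C_3=0.792$, $$b_C(n,\lambda,r,m)=\frac{1}{n^{\lambda+(r-1)/(2r)}}\Big(\frac{C_3\,r\ln n}{C\ln(r+1)}\Big)^{1/2}(4m)^{\lambda}.$$ Theorem. There are constants $0.4<C_1<0.5<C_2<0.6$ with $e^{6C_2}>34$ such that, for all $\alpha>0$ and all positive weights $\gamma$, one can choose for all $d,n\in\mathbb N$ a single vector $z=z_{d,n}\in\{0,\dots,N-1\}^d$ with the following properties. 1. If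 $c_1,c_2>0$ satisfy $c_1\frac{n}{\ln n}\le|P_n|\le c_2\frac{n}{\ln n}$ and $n\ge e^{6c_2}$, then, simultaneously for all $\lambda\in(0,\alpha)$ and all integers $r\ge1/(2\lambda)$, $$e_{d,n}(z)\le b_{c_1}(n,\lambda,r,\mu_d(\lambda)),$$ and, whenever $M(\lambda)<\infty$, also $e_{d,n}(z)\le b_{c_1}(n,\lambda,r,M(\lambda))$, where $M(\lambda)$ does not depend on $d$. 2. If $n\ge e^{6C_2}$, the two bounds in 1 hold for all these $\lambda$ and $r$ with $C_1$ in place of $c_1$. 3. For every $d$ and $\varepsilon>0$ there is $K$ with $e_{d,n}(z_{d,n})\le K\,n^{-\alpha-1/2+\varepsilon}$ for all $n\ge e^{6C_2}$. 4. If $\lambda\in(0,\alpha)$, $M(\lambda)<\infty$ and $\varepsilon>0$, there is $K$, not depending on $d$, with $e_{d,n}(z_{d,n})\le K\,n^{-\lambda-1/2+\varepsilon}$ for all $d\in\mathbb N$ and all $n\ge e^{6C_2}$. -/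

import Mathlib

open MeasureTheory Finset
open scoped ENNReal

noncomputable section

namespace RandomLattice

/-! Functions on `[0,1)^d` are treated as functions on the torus `(ℝ/ℤ)^d`, so that the points of a
shifted lattice rule are automatically reduced modulo one.  Coordinates are numbered `0, …, d - 1`,
and accordingly the weights are indexed by the finite subsets of `ℕ = {0, 1, 2, …}`. -/

/-- The uniform distribution on `[0,1)^d`: the product of the normalised Haar measures on the
circle. -/
def torusMeasure (d : ℕ) : Measure (UnitAddTorus (Fin d)) :=
  Measure.pi fun _ => AddCircle.haarAddCircle

/-- The integral `I_d(f)` over `[0,1]^d`. -/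
def torusIntegral {d : ℕ} (f : UnitAddTorus (Fin d) → ℂ) : ℂ :=
  ∫ x, f x ∂torusMeasure d

/-- The set of coordinates `j` with `h j ≠ 0`. -/
def freqSupport {d : ℕ} (h : Fin d → ℤ) : Finset ℕ :=
  (univ.filter fun j => h j ≠ 0).map Fin.valEmbedding

/-- `r_{α,γ}(h) = γ_{supp h}⁻¹ ∏_{j ∈ supp h} |h_j|^α`. -/
def korobovWeight (α : ℝ) (γ : Finset ℕ → ℝ) {d : ℕ} (h : Fin d → ℤ) : ℝ :=
  (γ (freqSupport h))⁻¹ * ∏ j ∈ univ.filter (fun j => h j ≠ 0), (|h j| : ℝ) ^ α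

/-- The Korobov norm, the square root of `∑_h |f̂(h)|² r_{α,γ}(h)²`, with values in `[0,∞]`. -/
def korobovNorm (α : ℝ) (γ : Finset ℕ → ℝ) {d : ℕ} (f : UnitAddTorus (Fin d) → ℂ) : ℝ≥0∞ :=
  (∑' h : Fin d → ℤ, ‖UnitAddTorus.mFourierCoeff f h‖ₑ ^ 2 *
    ENNReal.ofReal (korobovWeight α γ h) ^ 2) ^ (1 / 2 : ℝ)

/-- The weighted Korobov space: the square-integrable functions of finite Korobov norm. -/
def korobovSpace (α : ℝ) (γ : Finset ℕ → ℝ) (d : ℕ) : Set (UnitAddTorus (Fin d) → ℂ) :=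
  {f | MemLp f 2 (torusMeasure d) ∧ korobovNorm α γ f < ∞}

/-- The worst-case root mean square error over the unit ball of the Korobov space of a randomised
algorithm `A` whose randomness is drawn from the measure `P`. -/
def worstCaseRMSError (α : ℝ) (γ : Finset ℕ → ℝ) {d : ℕ} {Ω : Type} [MeasurableSpace Ω]
    (P : Measure Ω) (A : (UnitAddTorus (Fin d) → ℂ) → Ω → ℂ) : ℝ≥0∞ :=
  ⨆ f ∈ {f | f ∈ korobovSpace α γ d ∧ korobovNorm α γ f ≤ 1},
    (∫⁻ ω, ‖A f ω - torusIntegral f‖ₑ ^ 2 ∂P) ^ (1 / 2 : ℝ)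

/-- The rank-1 lattice rule with `n` points, generating vector `z` and shift `Δ`. -/
def shiftedLatticeRule {d : ℕ} (n : ℕ) (z : Fin d → ℤ) (Δ : UnitAddTorus (Fin d))
    (f : UnitAddTorus (Fin d) → ℂ) : ℂ :=
  1 / (n : ℂ) * ∑ k ∈ range n,
    f fun j => (((z j : ℝ) * (k : ℝ) / (n : ℝ) : ℝ) : UnitAddCircle) + Δ j

/-- The set of primes `p` with `n / 2 < p ≤ n`. -/
def primeRange (n : ℕ) : Finset ℕ :=
  (Icc 1 n).filter fun p => p.Prime ∧ (n : ℝ) / 2 < p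

/-- The joint law of a uniformly distributed prime in `(n/2, n]` and an independent uniformly
distributed shift. -/
def primeShiftMeasure (d n : ℕ) : Measure (ℕ × UnitAddTorus (Fin d)) :=
  (ProbabilityTheory.uniformOn (primeRange n : Set ℕ)).prod (torusMeasure d)

/-- The randomly shifted lattice rule with a random prime number of points and the fixed generating
vector `z`; the random event is the pair (number of points, shift). -/
def randomPrimeRule {d : ℕ} (z : Fin d → ℤ) (f : UnitAddTorus (Fin d) → ℂ)
    (ω : ℕ × UnitAddTorus (Fin d)) : ℂ :=
  shiftedLatticeRule ω.1 z ω.2 f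

/-- The worst-case root mean square error of the randomly shifted lattice rule with generating
vector `z` and a random prime number of points in `(n/2, n]`. -/
def rmsError (α : ℝ) (γ : Finset ℕ → ℝ) {d : ℕ} (n : ℕ) (z : Fin d → ℤ) : ℝ≥0∞ :=
  worstCaseRMSError α γ (primeShiftMeasure d n) (randomPrimeRule z)

/-- `μ_{d,α,γ,lam} = ∑_{h ≠ 0} r_{α,γ}(h)^{-1/lam}`. -/
def muQuantity (d : ℕ) (α : ℝ) (γ : Finset ℕ → ℝ) (lam : ℝ) : ℝ :=
  ∑' h : {h : Fin d → ℤ // h ≠ 0}, korobovWeight α γ h.1 ^ (-1 / lam)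

/-- The term `γ_u^{1/lam} (2 ζ(α/lam))^{|u|}` of the series in the summability condition. -/
def weightTerm (α : ℝ) (γ : Finset ℕ → ℝ) (lam : ℝ) (u : {u : Finset ℕ // u.Nonempty}) : ℝ :=
  γ u.1 ^ (1 / lam) * (2 * (riemannZeta ((α / lam : ℝ) : ℂ)).re) ^ u.1.card

/-- `n^{-(lam + (r-1)/(2r))} (C₃ r ln n / (C₁ ln (r+1)))^{1/2} (4 m)^lam` with `C₃ = 0.792`. -/
def errorBound (C₁ : ℝ) (n : ℕ) (lam : ℝ) (r : ℕ) (m : ℝ) : ℝ :=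
  1 / (n : ℝ) ^ (lam + ((r : ℝ) - 1) / (2 * r)) *
    (0.792 * r * Real.log n / (C₁ * Real.log (r + 1))) ^ (1 / 2 : ℝ) * (4 * m) ^ lam

end RandomLattice

end

/-!
For a random shift, Parseval's identity turns the mean square error of the rule with `p` points
into the sum of `|f̂(h)|²` over the nonzero `h` of the dual lattice, that is, those with `p ∣ h ·
z`.  Averaging over the primes `p` in `P = (n/2, n]` shows that the squared worst-case error is at
most the supremum over `h ≠ 0` of `k(h) / (|P| r(h)²)`, where `k(h)` is the number of `p` in `P`
dividing `h · z` (`rmsError_le_of_forall`, with `k = dualCount`).  A single vector `z` is needed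
for which `k(h)` is small whenever `r(h)` is.

To be uniform in `lam`, the weight of `h` is measured by its index `R(h)` (`korobovIndex`), the
number of nonzero frequencies of weight at most `r(h)`.  On the one hand `R(h) r(h) ^ (-1/lam) ≤
μ(lam)` for every `lam` in `(0, α)` (`korobovIndex_mul_le`).  On the other hand at most `X/q`
multiples of `q` have index at most `X` (`mul_card_le_of_korobovIndex_le`), so that counting by
`R` is as good as counting the integers up to `X`.

The vector `z` is given by its residues modulo the primes in `P`, and can be assembled from them
by the Chinese remainder theorem.  Modulo each `p`, only residue vectors are admitted whose dual
lattice contains no `h` with `4 R(h) < n` (multiples of `p` have larger index anyway); at least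
three quarters of the residue vectors qualify.  If the residues are chosen at random among them,
the expected number of frequencies `h` with `4 R(h) < H(k(h))` and `n < H(k(h))` is less than two,
provided that the sum of `H(k) (14 |P| / (3 n)) ^ k / k!` over the `k ≥ 1` with `n < H(k)` is less
than `8`.  As `h` and `-h` are bad together, some choice has no bad frequency at all
(`exists_generatingVector`).  Then `4 R(h) ≥ max (n, H(k(h)))` whenever `k(h) ≥ 1`.

The function `H(k)` is a constant times `y ^ k k!`, chosen such that `max (n, H(k))` dominates
`(k log (r + 1) / (C r)) ^ r` for all `r` simultaneously (`pow_log_le_factorial`), which makes `z`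
independent of `r` as well; together with `4 R(h) ≥ n` this gives the error bound by real-exponent arithmetic
(`rmsError_le_errorBound`).

The number of primes enters twice.  The convergence of the sum requires `|P|` to be at most a
suitable fraction of `n`, which `n ≥ e ^ (6 c₂)` provides.  For the numerical constant `C₁ > 0.4`
one would need `|P| ≥ C₁ n / log n`, but this fails for some small `n`, such as `n = 40`.  The
weaker bound `|P| ≥ 0.3281 n / log n` (`primeRange_bounds`) suffices, because for `n ≥ 37` there
is room to replace `C = 0.792` by `0.82 * 0.792` in the choice of `z`, and `0.3281 ≥ 0.82 *
0.4001`.  It is proved for `n ≤ 2 ^ 14` by a count of the integers coprime to a primorial, and for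
larger `n` by Chebyshev's method, applied to `T(n) - T(n/2) - T(n/13)` with `T` the logarithm of
`m! ⌊m/30⌋! / (⌊m/2⌋! ⌊m/3⌋! ⌊m/5⌋!)`.
-/

noncomputable section

namespace RandomLattice

/-! ### The number of primes in `(n/2, n]`: small `n` -/

/-- `1` if `m` is coprime to `Q`, and `0` otherwise (for `Q ≠ 0`), written with the arithmetic
operations on natural numbers that the kernel evaluates quickly. -/
def coprimeIndicator (Q m : ℕ) : ℕ := 1 - (Nat.gcd m Q - 1)

/-- Starting from the number `c` of integers in `(n/2, n]` coprime to `Q`, check the two estimates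
for the number of primes for the next `k` values of `n`.  The count is updated
from `n` to `n + 1` by adding `n + 1` and, if `n + 1` is even, removing `(n + 1)/2`. -/
def checkCounts (Q : ℕ) : ℕ → ℕ → ℕ → Bool
  | 0, _, _ => true
  | k + 1, n, c =>
    let c' := c + coprimeIndicator Q (n + 1) -
      (1 - (n + 1) % 2) * coprimeIndicator Q ((n + 1) / 2)
    Nat.ble (7 * c') (n + 1) && (Nat.ble (3281 * (n + 1)) (6931 * Nat.log2 (n + 1) * c') &&
      checkCounts Q k (n + 1) c')

/-- The number of integers in `(n/2, n]` coprime to `Q`. -/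
def coprimeCount (Q n : ℕ) : ℕ := #{m ∈ Ioc (n / 2) n | Nat.gcd m Q = 1}

/-- The interval `(18, 36]` contains the `4` primes `19, 23, 29, 31`, and `30030` is the product of
the primes up to `16`; the recursion covers `36 < n ≤ 300`. -/
theorem checkCounts_small : checkCounts 30030 264 36 (coprimeCount 30030 36) = true := by
  have : coprimeCount 30030 36 = 4 := by decide +kernel
  rw [this]; decide +kernel

theorem checkCounts_large :
    checkCounts (primorial 130) 16100 288 (coprimeCount (primorial 130) 288) = true := by
  have h : primorial 130 = 4014476939333036189094441199026045136645885247730 := by decide +kernel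
  rw [h]
  have : coprimeCount 4014476939333036189094441199026045136645885247730 288 = 27 := by decide +kernel
  rw [this]; decide +kernel

theorem coprimeIndicator_eq {Q : ℕ} (hQ : Q ≠ 0) (m : ℕ) :
    coprimeIndicator Q m = if Nat.gcd m Q = 1 then 1 else 0 := by
  have := Nat.gcd_pos_of_pos_right m (Nat.pos_of_ne_zero hQ)
  unfold coprimeIndicator
  split_ifs <;> omega

theorem coprimeCount_succ {Q : ℕ} (hQ : Q ≠ 0) (n : ℕ) :
    coprimeCount Q (n + 1) = coprimeCount Q n + coprimeIndicator Q (n + 1) -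
      (1 - (n + 1) % 2) * coprimeIndicator Q ((n + 1) / 2) := by
  have key : coprimeCount Q (n + 1) + (1 - (n + 1) % 2) * coprimeIndicator Q ((n + 1) / 2) =
      coprimeCount Q n + coprimeIndicator Q (n + 1) := by
    have h1 : coprimeCount Q n + coprimeIndicator Q (n + 1) =
        #{m ∈ Ioc (n / 2) (n + 1) | Nat.gcd m Q = 1} := by
      rw [coprimeIndicator_eq hQ, coprimeCount, ← Finset.insert_Ioc_right_eq_Ioc_add_one (by omega),
        filter_insert]
      split_ifs
      · rw [card_insert_of_notMem (by simp)]
      · rfl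
    rw [h1, coprimeIndicator_eq hQ, coprimeCount]
    rcases Nat.even_or_odd' (n + 1) with ⟨k, hk | hk⟩
    · have e1 : (n + 1) / 2 = n / 2 + 1 := by omega
      have e2 : (n + 1) % 2 = 0 := by omega
      rw [e1, e2, ← Finset.insert_Ioc_add_one_left_eq_Ioc (a := n / 2) (by omega), filter_insert]
      split_ifs
      · rw [card_insert_of_notMem (by simp)]
      · simp
    · have e1 : (n + 1) / 2 = n / 2 := by omega
      have e2 : (n + 1) % 2 = 1 := by omega
      rw [e1, e2]; simp
  omega

/-- The second estimate is `0.3281 m ≤ c · 0.6931 log₂ m`, with the logarithm rounded down. -/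
theorem checkCounts_spec {Q : ℕ} (hQ : Q ≠ 0) (k n : ℕ)
    (h : checkCounts Q k n (coprimeCount Q n) = true) (m : ℕ) (hm : n < m) (hmk : m ≤ n + k) :
    7 * coprimeCount Q m ≤ m ∧ 3281 * m ≤ 6931 * Nat.log2 m * coprimeCount Q m := by
  induction k generalizing n with
  | zero => omega
  | succ k ih =>
    simp only [checkCounts, ← coprimeCount_succ hQ, Bool.and_eq_true, Nat.ble_eq] at h
    rcases Nat.lt_or_ge (n + 1) m with hlt | hge
    · exact ih (n + 1) h.2.2 hlt (by omega)
    · obtain rfl : m = n + 1 := by omega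
      exact ⟨h.1, h.2.1⟩

theorem primeRange_eq (n : ℕ) : primeRange n = {p ∈ Ioc (n / 2) n | p.Prime} := by
  ext p
  have : (n : ℝ) / 2 < p ↔ n / 2 < p := by
    rw [div_lt_iff₀ (by norm_num), Nat.div_lt_iff_lt_mul (by norm_num)]
    exact_mod_cast Iff.rfl
  simp only [primeRange, mem_filter, mem_Icc, mem_Ioc, this]
  constructor
  · rintro ⟨⟨_, h⟩, hp, h2⟩; exact ⟨⟨h2, h⟩, hp⟩
  · rintro ⟨⟨h2, h⟩, hp⟩; exact ⟨⟨hp.one_lt.le, h⟩, hp, h2⟩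

/-- Trial division: between `s` and `(s + 1)²` the primes are the integers coprime to the product
of the primes up to `s`. -/
theorem card_primeRange_eq_coprimeCount {s n : ℕ} (h1 : s ≤ n / 2) (h1' : 1 ≤ n / 2)
    (h2 : n < (s + 1) ^ 2) :
    #(primeRange n) = coprimeCount (primorial s) n := by
  rw [primeRange_eq, coprimeCount]
  congr 1
  refine filter_congr fun m hm => ?_
  rw [mem_Ioc] at hm
  constructor
  · intro hp
    refine (hp.coprime_iff_not_dvd).2 fun hd => ?_
    have := (hp.dvd_primorial_iff).1 hd
    omega
  · intro hg
    by_contra hnp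
    have h1m : m ≠ 1 := by omega
    have hpr := Nat.minFac_prime h1m
    have hsq := Nat.minFac_sq_le_self (by omega) hnp
    have hle : m.minFac ≤ s := by
      by_contra hcon
      have : (s + 1) ^ 2 ≤ m.minFac ^ 2 := Nat.pow_le_pow_left (by omega) 2
      omega
    have hd : m.minFac ∣ Nat.gcd m (primorial s) :=
      Nat.dvd_gcd (Nat.minFac_dvd m) ((hpr.dvd_primorial_iff).2 hle)
    rw [hg] at hd
    exact hpr.one_lt.ne' (Nat.dvd_one.1 hd)

theorem primeRange_bounds_of_le {n : ℕ} (h1 : 37 ≤ n) (h2 : n ≤ 2 ^ 14) :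
    7 * #(primeRange n) ≤ n ∧ 0.3281 * n ≤ #(primeRange n) * Real.log n := by
  have key : 7 * #(primeRange n) ≤ n ∧ 3281 * n ≤ 6931 * Nat.log2 n * #(primeRange n) := by
    have hP : primorial 16 = 30030 := by decide +kernel
    rcases Nat.lt_or_ge 288 n with h | h
    · rw [card_primeRange_eq_coprimeCount (s := 130) (by omega) (by omega) (by omega)]
      exact checkCounts_spec (primorial_pos _).ne' 16100 288 checkCounts_large n h (by omega)
    · rw [card_primeRange_eq_coprimeCount (s := 16) (by omega) (by omega) (by omega), hP]
      exact checkCounts_spec (by norm_num) 264 36 checkCounts_small n (by omega) (by omega)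
  refine ⟨key.1, ?_⟩
  have hlog : (Nat.log2 n : ℝ) * 0.6931 ≤ Real.log n := by
    have h3 : (2 : ℝ) ^ Nat.log2 n ≤ n := by exact_mod_cast Nat.log2_self_le (by omega)
    have h4 := Real.log_le_log (by positivity) h3
    rw [Real.log_pow] at h4
    have := Real.log_two_gt_d9
    have h5 : (Nat.log2 n : ℝ) * 0.6931 ≤ Nat.log2 n * Real.log 2 := by
      gcongr; linarith
    linarith
  have h6 : (3281 * n : ℝ) ≤ 6931 * Nat.log2 n * #(primeRange n) := by exact_mod_cast key.2
  have h7 : (#(primeRange n) : ℝ) * (Nat.log2 n * 0.6931) ≤ #(primeRange n) * Real.log n := by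
    gcongr
  linarith

/-! ### The number of primes in `(n/2, n]`: large `n` -/

open ArithmeticFunction (vonMangoldt)

theorem sum_vonMangoldt_mul_div (n : ℕ) :
    ∑ d ∈ Ioc 0 n, vonMangoldt d * ((n / d : ℕ) : ℝ) = Real.log n.factorial := by
  have h1 : Real.log n.factorial = ∑ m ∈ Ioc 0 n, Real.log m := by
    induction n with
    | zero => simp
    | succ n ih =>
      rw [← Finset.insert_Ioc_right_eq_Ioc_add_one (Nat.zero_le n), sum_insert (by simp), ← ih,
        Nat.factorial_succ, Nat.cast_mul, Real.log_mul (by positivity) (by positivity)]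
  have h2 : ∀ m ∈ Ioc 0 n, Real.log m = ∑ d ∈ Ioc 0 n, if d ∣ m then vonMangoldt d else 0 := by
    intro m hm
    rw [mem_Ioc] at hm
    rw [← ArithmeticFunction.vonMangoldt_sum, ← sum_filter]
    refine sum_congr ?_ fun _ _ => rfl
    ext d
    simp only [Nat.mem_divisors, mem_filter, mem_Ioc]
    constructor
    · rintro ⟨hd, h0⟩
      exact ⟨⟨Nat.pos_of_dvd_of_pos hd hm.1, (Nat.le_of_dvd hm.1 hd).trans hm.2⟩, hd⟩
    · rintro ⟨_, hd⟩
      exact ⟨hd, hm.1.ne'⟩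
  rw [h1, sum_congr rfl h2, sum_comm]
  refine sum_congr rfl fun d _ => ?_
  rw [← sum_filter, sum_const, Nat.Ioc_filter_dvd_card_eq_div, nsmul_eq_mul, mul_comm]

theorem log_factorial_div_eq_sum {n m : ℕ} (j : ℕ) (hm : m ≤ n) :
    Real.log (m / j).factorial = ∑ d ∈ Ioc 0 n, vonMangoldt d * ((m / d / j : ℕ) : ℝ) := by
  rw [← sum_vonMangoldt_mul_div]
  have hsub : Ioc 0 (m / j) ⊆ Ioc 0 n :=
    Ioc_subset_Ioc_right ((Nat.div_le_self _ _).trans hm)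
  rw [← sum_subset hsub]
  · refine sum_congr rfl fun d _ => ?_
    rw [Nat.div_div_eq_div_mul, Nat.div_div_eq_div_mul, mul_comm j d]
  · intro d hd hd'
    rw [mem_Ioc] at hd hd'
    rw [Nat.div_div_eq_div_mul, mul_comm d j, ← Nat.div_div_eq_div_mul,
      Nat.div_eq_of_lt (by omega)]
    simp

/-- Chebyshev's combination `⌊u⌋ - ⌊u/2⌋ - ⌊u/3⌋ - ⌊u/5⌋ + ⌊u/30⌋`, which is `30`-periodic and takes
only the values `0` and `1`. -/
def chebyshevFloor (u : ℕ) : ℤ := u - (u / 2 : ℕ) - (u / 3 : ℕ) - (u / 5 : ℕ) + (u / 30 : ℕ)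

/-- The logarithm of `m! ⌊m/30⌋! / (⌊m/2⌋! ⌊m/3⌋! ⌊m/5⌋!)`. -/
def chebyshevSum (m : ℕ) : ℝ :=
  Real.log m.factorial - Real.log (m / 2).factorial - Real.log (m / 3).factorial -
    Real.log (m / 5).factorial + Real.log (m / 30).factorial

theorem chebyshevSum_eq {n m : ℕ} (hm : m ≤ n) :
    chebyshevSum m = ∑ d ∈ Ioc 0 n, vonMangoldt d * (chebyshevFloor (m / d) : ℝ) := by
  have h1 := log_factorial_div_eq_sum 1 hm
  simp only [Nat.div_one] at h1
  rw [chebyshevSum, h1, log_factorial_div_eq_sum 2 hm, log_factorial_div_eq_sum 3 hm,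
    log_factorial_div_eq_sum 5 hm, log_factorial_div_eq_sum 30 hm, ← sum_sub_distrib,
    ← sum_sub_distrib, ← sum_sub_distrib, ← sum_add_distrib]
  refine sum_congr rfl fun d _ => ?_
  simp only [chebyshevFloor, Int.cast_sub, Int.cast_add, Int.cast_natCast]
  ring

/-- Chebyshev's constant `log (2^{1/2} 3^{1/3} 5^{1/5} / 30^{1/30})`. -/
def chebyshevConst : ℝ := 14 / 30 * Real.log 2 + 9 / 30 * Real.log 3 + 5 / 30 * Real.log 5

theorem log_factorial_le {m : ℕ} (hm : 1 ≤ m) :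
    Real.log m.factorial ≤ m * Real.log m - m + Real.log m / 2 + 1 := by
  obtain ⟨k, rfl⟩ : ∃ k, m = k + 1 := ⟨m - 1, by omega⟩
  have h := Stirling.log_stirlingSeq'_antitone (Nat.zero_le k)
  simp only [Function.comp, Nat.succ_eq_add_one, zero_add] at h
  rw [Stirling.log_stirlingSeq_formula, Stirling.log_stirlingSeq_formula] at h
  have hk : (0 : ℝ) < ((k + 1 : ℕ) : ℝ) := by positivity
  rw [Real.log_mul (by norm_num) hk.ne', Real.log_div hk.ne' (Real.exp_pos 1).ne',
    Real.log_exp] at h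
  simp at h ⊢
  linarith

/-- Stirling's upper bound for `⌊x⌋!` in terms of `x = m / j`. -/
theorem log_factorial_div_le {m j : ℕ} (hj : 1 ≤ j) (hm : j ≤ m) :
    Real.log (m / j).factorial ≤
      (m / j : ℝ) * Real.log (m / j : ℝ) - m / j + Real.log (m / j : ℝ) / 2 + 1 := by
  set q := m / j with hq
  have hq1 : 1 ≤ q := (Nat.one_le_div_iff (by omega)).2 hm
  have hqx : (q : ℝ) ≤ m / j := Nat.cast_div_le
  set x : ℝ := m / j
  have hq1' : (1 : ℝ) ≤ q := by exact_mod_cast hq1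
  refine (log_factorial_le hq1).trans ?_
  have hlog : Real.log q ≤ Real.log x := Real.log_le_log (by linarith) hqx
  have h0 : 0 ≤ Real.log q := Real.log_nonneg hq1'
  have key : x * (Real.log q - Real.log x) ≤ q - x := by
    have := Real.log_le_sub_one_of_pos (show 0 < (q : ℝ) / x from div_pos (by linarith) (by linarith))
    rw [Real.log_div (by positivity) (by linarith)] at this
    have hx : 0 < x := by linarith
    calc x * (Real.log q - Real.log x) ≤ x * (q / x - 1) := by gcongr
      _ = q - x := by field_simp
  nlinarith [mul_nonneg (sub_nonneg.2 hqx) h0]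

/-- Stirling's lower bound for `⌊x⌋!` in terms of `x = m / j`. -/
theorem le_log_factorial_div {m j : ℕ} (hj : 1 ≤ j) (hm : j ≤ m) :
    (m / j : ℝ) * Real.log (m / j : ℝ) - m / j - Real.log (m / j : ℝ) ≤
      Real.log (m / j).factorial := by
  set q := m / j with hq
  have hq1 : 1 ≤ q := (Nat.one_le_div_iff (by omega)).2 hm
  have hqx : (q : ℝ) ≤ m / j := Nat.cast_div_le
  have hxq : (m / j : ℝ) ≤ q + 1 := by
    rw [div_le_iff₀ (by positivity)]
    have := Nat.lt_mul_div_succ m (show 0 < j by omega)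
    rw [← hq] at this
    have h2 : m ≤ (q + 1) * j := by rw [mul_comm]; omega
    exact_mod_cast h2
  set x : ℝ := m / j
  have hq1' : (1 : ℝ) ≤ q := by exact_mod_cast hq1
  have hst := Stirling.le_log_factorial_stirling (show q ≠ 0 by omega)
  have hpi : 0 ≤ Real.log (2 * Real.pi) := Real.log_nonneg (by nlinarith [Real.pi_gt_three])
  have h0 : 0 ≤ Real.log q := Real.log_nonneg hq1'
  have hlog : Real.log q ≤ Real.log x := Real.log_le_log (by linarith) hqx
  have key : q * (Real.log x - Real.log q) ≤ x - q := by
    have := Real.log_le_sub_one_of_pos (show 0 < x / (q : ℝ) from div_pos (by linarith) (by linarith))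
    rw [Real.log_div (by linarith) (by positivity)] at this
    calc q * (Real.log x - Real.log q) ≤ q * (x / q - 1) := by gcongr
      _ = x - q := by field_simp
  nlinarith [mul_nonneg (sub_nonneg.2 hxq) (h0.trans hlog)]

theorem le_chebyshevSum {m : ℕ} (hm : 30 ≤ m) :
    chebyshevConst * m - 5 / 2 * Real.log m ≤ chebyshevSum m := by
  have hm0 : (0 : ℝ) < m := by positivity
  have h1 := Stirling.le_log_factorial_stirling (show m ≠ 0 by omega)
  have h2 := log_factorial_div_le (m := m) (j := 2) (by omega) (by omega)
  have h3 := log_factorial_div_le (m := m) (j := 3) (by omega) (by omega)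
  have h5 := log_factorial_div_le (m := m) (j := 5) (by omega) (by omega)
  have h30 := le_log_factorial_div (m := m) (j := 30) (by omega) (by omega)
  have hpi : 0 ≤ Real.log (2 * Real.pi) := Real.log_nonneg (by nlinarith [Real.pi_gt_three])
  have e30 : Real.log 30 = Real.log 2 + Real.log 3 + Real.log 5 := by
    rw [← Real.log_mul (by norm_num) (by norm_num), ← Real.log_mul (by norm_num) (by norm_num)]
    norm_num
  push_cast at h2 h3 h5 h30
  rw [Real.log_div hm0.ne' (by norm_num)] at h2 h3 h5 h30
  rw [e30] at h30
  have l2 := Real.log_two_gt_d9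
  have l3 := Real.log_three_gt_d9
  have l5 := Real.log_five_gt_d9
  have l0 : 0 ≤ Real.log m := Real.log_nonneg (by exact_mod_cast (by omega : 1 ≤ m))
  simp only [chebyshevSum, chebyshevConst]
  linarith

theorem chebyshevSum_le {m : ℕ} (hm : 30 ≤ m) :
    chebyshevSum m ≤ chebyshevConst * m + 4 * Real.log m := by
  have hm0 : (0 : ℝ) < m := by positivity
  have h1 := log_factorial_le (show 1 ≤ m by omega)
  have h2 := le_log_factorial_div (m := m) (j := 2) (by omega) (by omega)
  have h3 := le_log_factorial_div (m := m) (j := 3) (by omega) (by omega)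
  have h5 := le_log_factorial_div (m := m) (j := 5) (by omega) (by omega)
  have h30 := log_factorial_div_le (m := m) (j := 30) (by omega) (by omega)
  have e30 : Real.log 30 = Real.log 2 + Real.log 3 + Real.log 5 := by
    rw [← Real.log_mul (by norm_num) (by norm_num), ← Real.log_mul (by norm_num) (by norm_num)]
    norm_num
  push_cast at h2 h3 h5 h30
  rw [Real.log_div hm0.ne' (by norm_num)] at h2 h3 h5 h30
  rw [e30] at h30
  have l2 := Real.log_two_gt_d9
  have l3 := Real.log_three_gt_d9
  have l5 := Real.log_five_gt_d9
  simp only [chebyshevSum, chebyshevConst]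
  linarith

theorem chebyshevFloor_add_thirty (u : ℕ) : chebyshevFloor (u + 30) = chebyshevFloor u := by
  simp only [chebyshevFloor]; omega

theorem chebyshevFloor_mem (u : ℕ) : 0 ≤ chebyshevFloor u ∧ chebyshevFloor u ≤ 1 := by
  induction u using Nat.strong_induction_on with
  | _ u ih =>
    rcases Nat.lt_or_ge u 30 with h | h
    · clear ih; revert u; decide
    · obtain ⟨v, rfl⟩ := Nat.exists_eq_add_of_le' h
      rw [chebyshevFloor_add_thirty]
      exact ih v (by omega)

/-- The coefficient of `Λ d`, as a function of `u = ⌊n/d⌋`, in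
`chebyshevSum n - chebyshevSum (n/2) - chebyshevSum (n/13)`. -/
def primeGapCoeff (u : ℕ) : ℤ :=
  chebyshevFloor u - chebyshevFloor (u / 2) - chebyshevFloor (u / 13)

theorem primeGapCoeff_le_one (u : ℕ) : primeGapCoeff u ≤ 1 := by
  have h1 := chebyshevFloor_mem u
  have h2 := chebyshevFloor_mem (u / 2)
  have h3 := chebyshevFloor_mem (u / 13)
  simp only [primeGapCoeff]; omega

/-- The subtraction of `chebyshevFloor (u / 13)` removes the positive coefficients that
`chebyshevFloor u - chebyshevFloor (u / 2)` has in this range. -/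
theorem primeGapCoeff_nonpos {u : ℕ} (h2 : 2 ≤ u) (h133 : u < 133) : primeGapCoeff u ≤ 0 := by
  revert u; decide +kernel

/-- The main term is `1 - 1/2 - 1/13 = 11/26` times Chebyshev's constant. -/
theorem sum_primeGapCoeff_ge {n : ℕ} (hn : 390 ≤ n) :
    11 / 26 * chebyshevConst * n - 21 / 2 * Real.log n ≤
      ∑ d ∈ Ioc 0 n, vonMangoldt d * (primeGapCoeff (n / d) : ℝ) := by
  have hA : 0 ≤ chebyshevConst := by unfold chebyshevConst; positivity
  have e : ∑ d ∈ Ioc 0 n, vonMangoldt d * (primeGapCoeff (n / d) : ℝ) =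
      chebyshevSum n - chebyshevSum (n / 2) - chebyshevSum (n / 13) := by
    rw [chebyshevSum_eq le_rfl, chebyshevSum_eq (Nat.div_le_self n 2),
      chebyshevSum_eq (Nat.div_le_self n 13), ← sum_sub_distrib, ← sum_sub_distrib]
    refine sum_congr rfl fun d _ => ?_
    rw [primeGapCoeff, Nat.div_div_eq_div_mul, Nat.div_div_eq_div_mul, Nat.div_div_eq_div_mul,
      Nat.div_div_eq_div_mul, mul_comm d 2, mul_comm d 13]
    push_cast; ring
  have key : ∀ j : ℕ, 1 ≤ j → j * 30 ≤ n →
      chebyshevSum (n / j) ≤ chebyshevConst * (n / j) + 4 * Real.log n := by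
    intro j hj hjn
    have h30 : 30 ≤ n / j := (Nat.le_div_iff_mul_le (by omega)).2 (by rw [mul_comm]; exact hjn)
    refine (chebyshevSum_le h30).trans ?_
    have : ((n / j : ℕ) : ℝ) ≤ n / j := Nat.cast_div_le
    have h4 : Real.log ((n / j : ℕ) : ℝ) ≤ Real.log n :=
      Real.log_le_log (by positivity) (by exact_mod_cast Nat.div_le_self n j)
    gcongr
  have h1 := le_chebyshevSum (show 30 ≤ n by omega)
  have h2 := key 2 (by omega) (by omega)
  have h3 := key 13 (by omega) (by omega)
  rw [e]
  push_cast at h2 h3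
  linarith

theorem card_primes_le (s : ℕ) : #{p ∈ Ioc 0 s | p.Prime} ≤ (s + 1) / 2 := by
  have : #{p ∈ Ioc 0 s | p.Prime} ≤ #(Ioc 0 ((s + 1) / 2)) := by
    refine card_le_card_of_injOn (fun p => (p + 1) / 2) ?_ ?_
    · intro p hp
      simp only [coe_filter, mem_Ioc, Set.mem_ofPred_eq, coe_Ioc, Set.mem_Ioc] at hp ⊢
      omega
    · intro p hp q hq h
      simp only [coe_filter, mem_Ioc, Set.mem_ofPred_eq] at hp hq h
      rcases hp.2.eq_two_or_odd with h1 | h1 <;> rcases hq.2.eq_two_or_odd with h2 | h2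
      · omega
      · have := hq.2.two_le; omega
      · have := hp.2.two_le; omega
      · omega
  simpa using this

/-- Only the primes up to `√n` have proper powers below `n`, and those of each such prime
contribute at most `log n` to `ψ(n)`. -/
theorem psi_sub_theta_le_of_sqrt {n : ℕ} (hn : 1 ≤ n) :
    Chebyshev.psi n - Chebyshev.theta n ≤ (Real.sqrt n + 1) / 2 * Real.log n := by
  rw [Chebyshev.psi_eq_sum_mul_log_prime, Chebyshev.theta_eq_sum_primesLE_log, ← sum_sub_distrib]
  have hl : 0 ≤ Real.log n := Real.log_nonneg (by exact_mod_cast hn)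
  have hterm : ∀ p ∈ Nat.primesLE n, (Nat.log p n : ℝ) * Real.log p - Real.log p ≤
      if p ≤ Nat.sqrt n then Real.log n else 0 := by
    intro p hp
    have hpp := Nat.prime_of_mem_primesLE hp
    have hpos : 0 ≤ Real.log p := Real.log_nonneg (by exact_mod_cast hpp.one_lt.le)
    split_ifs with h
    · have : (Nat.log p n : ℝ) * Real.log p ≤ Real.log n := by
        refine Real.le_log_of_pow_le (by exact_mod_cast hpp.pos) ?_
        exact_mod_cast Nat.pow_log_le_self p (by omega)
      linarith
    · have h1 : Nat.log p n ≤ 1 := by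
        have h2 : n < p ^ 2 := by
          rw [pow_two]; exact Nat.sqrt_lt.1 (by omega)
        have := Nat.log_lt_of_lt_pow (by omega) h2
        omega
      have : (Nat.log p n : ℝ) * Real.log p ≤ 1 * Real.log p := by
        gcongr; exact_mod_cast h1
      linarith
  refine (sum_le_sum hterm).trans ?_
  rw [← sum_filter, sum_const, nsmul_eq_mul]
  gcongr
  have hsub : {p ∈ Nat.primesLE n | p ≤ Nat.sqrt n} ⊆ {p ∈ Ioc 0 (Nat.sqrt n) | p.Prime} := by
    intro p hp
    rw [mem_filter] at hp
    have := Nat.prime_of_mem_primesLE hp.1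
    rw [mem_filter, mem_Ioc]
    exact ⟨⟨this.pos, hp.2⟩, this⟩
  have h1 := (card_le_card hsub).trans (card_primes_le _)
  have h2 : 2 * #{p ∈ Nat.primesLE n | p ≤ Nat.sqrt n} ≤ Nat.sqrt n + 1 := by omega
  have h3 : (2 * #{p ∈ Nat.primesLE n | p ≤ Nat.sqrt n} : ℝ) ≤ Nat.sqrt n + 1 := by
    exact_mod_cast h2
  have h4 : (Nat.sqrt n : ℝ) ≤ Real.sqrt n := Real.nat_sqrt_le_real_sqrt
  linarith

/-- The three terms bound the contributions of the primes in `(n/2, n]`, of the primes up to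
`n / 133` and of the proper prime powers; the other primes contribute nothing positive. -/
theorem sum_primeGapCoeff_le {n : ℕ} (hn : 1 ≤ n) :
    ∑ d ∈ Ioc 0 n, vonMangoldt d * (primeGapCoeff (n / d) : ℝ) ≤
      #(primeRange n) * Real.log n + Real.log 4 * (n / 133) +
        (Real.sqrt n + 1) / 2 * Real.log n := by
  have hpt : ∀ d ∈ Ioc 0 n, vonMangoldt d * (primeGapCoeff (n / d) : ℝ) ≤
      (if d ∈ primeRange n then Real.log n else 0) +
      (if d.Prime ∧ d ≤ n / 133 then Real.log d else 0) +
      (if ¬ d.Prime then vonMangoldt d else 0) := by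
    intro d hd
    rw [mem_Ioc] at hd
    have hn' : 0 ≤ Real.log n := Real.log_nonneg (by exact_mod_cast hn)
    have hd' : 0 ≤ Real.log d := Real.log_nonneg (by exact_mod_cast hd.1)
    have hΛ : 0 ≤ vonMangoldt d := ArithmeticFunction.vonMangoldt_nonneg
    have hle : vonMangoldt d * (primeGapCoeff (n / d) : ℝ) ≤ vonMangoldt d := by
      have : (primeGapCoeff (n / d) : ℝ) ≤ 1 := by exact_mod_cast primeGapCoeff_le_one _
      nlinarith
    by_cases hp : d.Prime
    · simp only [hp, true_and, not_true_eq_false, if_false, add_zero]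
      have hΛd : vonMangoldt d = Real.log d := ArithmeticFunction.vonMangoldt_apply_prime hp
      have hdn : Real.log d ≤ Real.log n :=
        Real.log_le_log (by exact_mod_cast hd.1) (by exact_mod_cast hd.2)
      by_cases h1 : d ∈ primeRange n
      · rw [if_pos h1]
        have : (0 : ℝ) ≤ if d ≤ n / 133 then Real.log d else 0 := by split_ifs <;> simp [hd']
        linarith
      · rw [if_neg h1]
        by_cases h2 : d ≤ n / 133
        · rw [if_pos h2]; linarith
        · rw [if_neg h2]
          have hle2 : d ≤ n / 2 := by
            by_contra hcon
            refine h1 ?_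
            rw [primeRange_eq, mem_filter, mem_Ioc]
            exact ⟨⟨by omega, hd.2⟩, hp⟩
          have hu2 : 2 ≤ n / d := (Nat.le_div_iff_mul_le hd.1).2 (by omega)
          have hu3 : n / d < 133 := by
            rw [Nat.div_lt_iff_lt_mul hd.1]
            have := Nat.lt_mul_div_succ n (show 0 < 133 by norm_num)
            nlinarith
          have : (primeGapCoeff (n / d) : ℝ) ≤ 0 := by
            exact_mod_cast primeGapCoeff_nonpos hu2 hu3
          nlinarith
    · simp only [hp, false_and, if_false, not_false_eq_true, if_true]
      split_ifs <;> linarith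
  refine (sum_le_sum hpt).trans ?_
  rw [sum_add_distrib, sum_add_distrib]
  gcongr ?_ + ?_ + ?_
  · rw [← sum_filter, sum_const, nsmul_eq_mul]
    gcongr
    intro d hd
    exact (mem_filter.1 hd).2
  · have h133 : ((n / 133 : ℕ) : ℝ) ≤ n / 133 := Nat.cast_div_le
    calc ∑ d ∈ Ioc 0 n, (if d.Prime ∧ d ≤ n / 133 then Real.log d else 0)
        = Chebyshev.theta (n / 133 : ℕ) := by
          rw [Chebyshev.theta, Nat.floor_natCast, ← sum_filter]
          refine sum_congr ?_ fun _ _ => rfl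
          ext d
          simp only [mem_filter, mem_Ioc]
          have := Nat.div_le_self n 133
          constructor
          · rintro ⟨⟨a, b⟩, c, e⟩; exact ⟨⟨a, e⟩, c⟩
          · rintro ⟨⟨a, b⟩, c⟩; exact ⟨⟨a, by omega⟩, c, b⟩
      _ ≤ Real.log 4 * (n / 133 : ℕ) := Chebyshev.theta_le_log4_mul_x (by positivity)
      _ ≤ _ := by gcongr
  · rw [← sum_filter]
    have h := Chebyshev.psi_sub_theta_eq_sum_not_prime n
    rw [Nat.floor_natCast] at h
    rw [← h]
    exact psi_sub_theta_le_of_sqrt hn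

theorem primeRange_lower_of_ge {n : ℕ} (hn : 2 ^ 14 ≤ n) :
    0.3281 * n ≤ #(primeRange n) * Real.log n := by
  have h1 := (sum_primeGapCoeff_ge (n := n) (by omega)).trans (sum_primeGapCoeff_le (by omega))
  have hA : 0.9212 ≤ chebyshevConst := by
    have l2 := Real.log_two_gt_d9
    have l3 := Real.log_three_gt_d9
    have l5 := Real.log_five_gt_d9
    unfold chebyshevConst; linarith
  have l4 : Real.log 4 ≤ 1.3863 := by
    have l2 := Real.log_two_lt_d9
    rw [show (4 : ℝ) = 2 ^ 2 by norm_num, Real.log_pow]; push_cast; linarith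
  set s := Real.sqrt n with hs
  have hn0 : (0 : ℝ) < n := by positivity
  have hs2 : s ^ 2 = n := Real.sq_sqrt hn0.le
  have hs128 : 128 ≤ s := Real.le_sqrt_of_sq_le (by norm_num; exact_mod_cast hn)
  -- the tangent of the logarithm at `128 = √(2 ^ 14)`
  have hlog : Real.log n ≤ 2 * (3.8521 + s / 128) := by
    have e : Real.log n = 2 * Real.log s := by rw [← hs2, Real.log_pow]; norm_num
    have h128 : Real.log 128 ≤ 4.8521 := by
      have l2 := Real.log_two_lt_d9
      rw [show (128 : ℝ) = 2 ^ 7 by norm_num, Real.log_pow]; push_cast; linarith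
    have := Real.log_le_sub_one_of_pos (show 0 < s / 128 by positivity)
    rw [Real.log_div (by positivity) (by norm_num)] at this
    rw [e]; linarith
  have hAn : 0.9212 * (n : ℝ) ≤ chebyshevConst * n := by gcongr
  have h4n : Real.log 4 * ((n : ℝ) / 133) ≤ 1.3863 * (n / 133) := by gcongr
  have h5 : (s + 22) / 2 * Real.log n ≤ (s + 22) / 2 * (2 * (3.8521 + s / 128)) := by gcongr
  nlinarith

/-- Among the integers, `8` out of `30` are coprime to `30`, and `8/30 · 1/2 < 1/7`. -/
theorem seven_mul_card_primeRange_le_of_ge {n : ℕ} (hn : 2 ^ 14 ≤ n) :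
    7 * #(primeRange n) ≤ n := by
  have hsub : primeRange n ⊆
      {m ∈ Ico (n / 2 + 1) (n / 2 + 1 + (n - n / 2)) | Nat.Coprime 30 m} := by
    rw [primeRange_eq]
    intro p hp
    rw [mem_filter, mem_Ioc] at hp
    rw [mem_filter, mem_Ico]
    refine ⟨by omega, ?_⟩
    rw [Nat.coprime_comm, hp.2.coprime_iff_not_dvd]
    intro h
    have := Nat.le_of_dvd (by norm_num) h
    omega
  have h := (card_le_card hsub).trans (Nat.Ico_filter_coprime_le (a := 30) _ _ (by norm_num))
  have h8 : Nat.totient 30 = 8 := by decide +kernel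
  rw [h8] at h
  omega

/-- The number of primes in `(n/2, n]` is at most `n / 7` and at least `0.3281 n / log n`. -/
theorem primeRange_bounds {n : ℕ} (hn : 37 ≤ n) :
    7 * #(primeRange n) ≤ n ∧ 0.3281 * n ≤ #(primeRange n) * Real.log n := by
  rcases Nat.le_total n (2 ^ 14) with h | h
  · exact primeRange_bounds_of_le hn h
  · exact ⟨seven_mul_card_primeRange_le_of_ge h, primeRange_lower_of_ge h⟩

/-! ### A uniform bound for `(k log (r + 1) / (C r)) ^ r` -/

/-- The bound holds for all `r` at once.  Writing `τ = ¾ log (r + 1)`, one has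
`(k τ / r) ^ r ≤ exp (k τ - r)` and `exp (k τ) = (r + 1) ^ (3 k / 4)`, which is compared with `k!`
by Stirling's formula; the remaining `(r + 1) ^ (3/4)` in the exponent is replaced by its tangent
at `r + 1 = w ^ 4`. -/
theorem pow_log_le_factorial {C y c w : ℝ} (hC : 0 < C) (hy : 0 < y) (hw : 0 < w)
    (h1 : Real.exp (3 / (4 * w * y)) ≤ Real.exp 1 * (3 / 4 * C))
    (h2 : Real.exp (3 / (4 * w * y) + w ^ 3 / (4 * y)) ≤ c)
    {k r : ℕ} (hk : 1 ≤ k) (hr : 1 ≤ r) :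
    (k * Real.log (r + 1) / (C * r)) ^ r ≤
      c * y ^ k * k.factorial / Real.sqrt (2 * Real.pi * k) := by
  set s := 3 / (4 * w * y) with hs
  have hk0 : (0 : ℝ) < k := by exact_mod_cast hk
  have hr0 : (0 : ℝ) < r := by exact_mod_cast hr
  set L := Real.log (r + 1) with hL
  set τ := 3 / 4 * L with hτ
  set κ := Real.exp τ / y with hκ
  have hκ0 : 0 < κ := by positivity
  -- the tangent of `(r + 1) ^ (3/4)`
  have htan : κ ≤ s * (r + 1) + w ^ 3 / (4 * y) := by
    set t := Real.exp (L / 4) with ht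
    have ht4 : t ^ 4 = r + 1 := by
      rw [ht, ← Real.exp_nat_mul, show ((4 : ℕ) : ℝ) * (L / 4) = L by push_cast; ring, hL,
        Real.exp_log (by positivity)]
    have ht3 : t ^ 3 = Real.exp τ := by
      rw [ht, ← Real.exp_nat_mul, hτ]; congr 1; push_cast; ring
    have hamgm : 4 * w * t ^ 3 ≤ 3 * t ^ 4 + w ^ 4 := by
      have : 0 ≤ (t - w) ^ 2 * (3 * t ^ 2 + 2 * t * w + w ^ 2) := by positivity
      nlinarith
    rw [hκ, ← ht3, ← ht4, hs, div_mul_eq_mul_div, div_add_div _ _ (by positivity) (by positivity),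
      div_le_div_iff₀ (by positivity) (by positivity)]
    have := mul_le_mul_of_nonneg_left hamgm (show 0 ≤ 4 * y ^ 2 by positivity)
    nlinarith
  have hpow1 : (k * τ / r) ^ r ≤ Real.exp τ ^ k * Real.exp (-1) ^ r := by
    have h0 : 0 ≤ k * τ / r := by
      have : 0 ≤ L := Real.log_nonneg (by linarith)
      positivity
    calc (k * τ / r) ^ r ≤ Real.exp (k * τ / r - 1) ^ r := by
          gcongr; linarith [Real.add_one_le_exp (k * τ / r - 1)]
      _ = Real.exp τ ^ k * Real.exp (-1) ^ r := by
          rw [← Real.exp_nat_mul, ← Real.exp_nat_mul, ← Real.exp_nat_mul, ← Real.exp_add]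
          congr 1; field_simp; ring
  have hpow2 : κ ^ k ≤ (k / Real.exp 1) ^ k * Real.exp κ := by
    have h0 : (κ / k) ^ k ≤ Real.exp κ * Real.exp (-1) ^ k := by
      calc (κ / k) ^ k ≤ Real.exp (κ / k - 1) ^ k := by
            gcongr; linarith [Real.add_one_le_exp (κ / k - 1)]
        _ = Real.exp κ * Real.exp (-1) ^ k := by
            rw [← Real.exp_nat_mul, ← Real.exp_nat_mul, ← Real.exp_add]
            congr 1; field_simp; ring
    have e : (k / Real.exp 1) ^ k * Real.exp κ = (k : ℝ) ^ k * (Real.exp κ * Real.exp (-1) ^ k) := by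
      rw [Real.exp_neg, div_pow, inv_pow]; field_simp
    rw [e]
    calc κ ^ k = (k : ℝ) ^ k * (κ / k) ^ k := by rw [← mul_pow]; congr 1; field_simp
      _ ≤ _ := by gcongr
  have hst := Stirling.le_factorial_stirling k
  have hsq : 0 < Real.sqrt (2 * Real.pi * k) := by positivity
  have hbase : k * L / (C * r) = (k * τ / r) / (3 / 4 * C) := by
    rw [hτ]; field_simp
  have hexps : Real.exp (-1) ^ r / (3 / 4 * C) ^ r ≤ Real.exp (-(s * r)) := by
    rw [← div_pow, show Real.exp (-(s * r)) = Real.exp (-s) ^ r by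
      rw [← Real.exp_nat_mul]; congr 1; ring]
    gcongr
    rw [Real.exp_neg, Real.exp_neg, div_eq_mul_inv, ← mul_inv]
    exact inv_anti₀ (Real.exp_pos _) h1
  calc (k * L / (C * r)) ^ r = (k * τ / r) ^ r / (3 / 4 * C) ^ r := by rw [hbase, div_pow]
    _ ≤ Real.exp τ ^ k * Real.exp (-1) ^ r / (3 / 4 * C) ^ r := by gcongr
    _ = (κ ^ k * y ^ k) * (Real.exp (-1) ^ r / (3 / 4 * C) ^ r) := by
        rw [mul_div_assoc, ← mul_pow, hκ, div_mul_cancel₀ _ hy.ne']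
    _ ≤ (((k / Real.exp 1) ^ k * Real.exp κ) * y ^ k) * Real.exp (-(s * r)) := by gcongr
    _ = (k / Real.exp 1) ^ k * y ^ k * Real.exp (κ - s * r) := by
        rw [sub_eq_add_neg, Real.exp_add]; ring
    _ ≤ (k.factorial / Real.sqrt (2 * Real.pi * k)) * y ^ k * c := by
        gcongr
        · rw [le_div_iff₀ hsq, mul_comm]; exact hst
        · refine le_trans (Real.exp_le_exp.2 ?_) h2
          linarith
    _ = _ := by ring

theorem exp_le_of_sum_range {x b : ℝ} (hx0 : 0 ≤ x) (hx1 : x ≤ 1)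
    (h : 1 + x + x ^ 2 / 2 + x ^ 3 / 6 + x ^ 4 / 24 + x ^ 5 * (6 / 600) ≤ b) : Real.exp x ≤ b := by
  have := Real.exp_bound' hx0 hx1 (n := 5) (by norm_num)
  simp only [sum_range_succ, sum_range_zero, Nat.factorial] at this
  norm_num at this
  linarith

/-- The case `y = 0.92 < 9/7`, which makes the geometric series of ratio `7 y / 9` converge.  The
tangent is taken at `w = 7/4`, for which both numerical conditions hold with little to spare. -/
theorem pow_log_le_small {k r : ℕ} (hk : 1 ≤ k) (hr : 1 ≤ r) :
    (k * Real.log (r + 1) / (0.792 * r)) ^ r ≤ 2.75 * 0.92 ^ k * k.factorial := by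
  have he := Real.exp_one_gt_d9
  have h := pow_log_le_factorial (C := 0.792) (y := 0.92) (c := 6.85) (w := 7 / 4) (by norm_num)
    (by norm_num) (by norm_num) ?_ ?_ hk hr
  · refine h.trans ?_
    have hk1 : (1 : ℝ) ≤ k := by exact_mod_cast hk
    have hsq : 2.5 ≤ Real.sqrt (2 * Real.pi * k) := by
      refine Real.le_sqrt_of_sq_le ?_
      nlinarith [Real.pi_gt_d2, Real.pi_pos]
    rw [div_le_iff₀ (by linarith)]
    have h0 : (0 : ℝ) ≤ 0.92 ^ k * k.factorial := by positivity
    nlinarith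
  · refine (exp_le_of_sum_range (b := 1.6) (by norm_num) (by norm_num) (by norm_num)).trans ?_
    linarith
  · have : Real.exp (3 / (4 * (7 / 4) * 0.92) + (7 / 4) ^ 3 / (4 * 0.92)) = Real.exp 0.9612 ^ 2 *
        Real.exp (3 / (4 * (7 / 4) * 0.92) + (7 / 4) ^ 3 / (4 * 0.92) - 2 * 0.9612) := by
      rw [← Real.exp_nat_mul, ← Real.exp_add]; congr 1; push_cast; ring
    have h0 : Real.exp ((3 / (4 * (7 / 4) * 0.92) + (7 / 4) ^ 3 / (4 * 0.92) - 2 * 0.9612 : ℝ)) ≤ 1 :=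
      Real.exp_le_one_iff.2 (by norm_num)
    have h1 : Real.exp 0.9612 ≤ 2.617 :=
      exp_le_of_sum_range (by norm_num) (by norm_num) (by norm_num)
    rw [this]
    calc _ ≤ (2.617 : ℝ) ^ 2 * 1 := by gcongr
      _ ≤ 6.85 := by norm_num

/-- The version with the constant `0.82 * 0.792`.  The larger `y = 1.23 < 3/2` and the exclusion of
the values `k ≤ 3` by the bound `37` make this possible. -/
theorem pow_log_le_large {k r : ℕ} (hk : 1 ≤ k) (hr : 1 ≤ r) :
    (k * Real.log (r + 1) / (0.82 * 0.792 * r)) ^ r ≤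
      max (37 : ℝ) (2.31 * 1.23 ^ k * k.factorial) := by
  have he := Real.exp_one_gt_d9
  have h := pow_log_le_factorial (C := 0.82 * 0.792) (y := 1.23) (c := 11.55) (w := 2.2) (by norm_num)
    (by norm_num) (by norm_num) ?_ ?_ hk hr
  · refine h.trans ?_
    have hk1 : (1 : ℝ) ≤ k := by exact_mod_cast hk
    rcases Nat.lt_or_ge k 4 with h4 | h4
    · refine le_max_of_le_left ?_
      interval_cases k
      · have hsq : 2.5 ≤ Real.sqrt (2 * Real.pi * (1 : ℕ)) := by
          refine Real.le_sqrt_of_sq_le ?_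
          push_cast; nlinarith [Real.pi_gt_d2, Real.pi_pos]
        rw [div_le_iff₀ (lt_of_lt_of_le (by norm_num) hsq)]
        norm_num [Nat.factorial] at *; linarith
      · have hsq : 3.5 ≤ Real.sqrt (2 * Real.pi * (2 : ℕ)) := by
          refine Real.le_sqrt_of_sq_le ?_
          push_cast; nlinarith [Real.pi_gt_d2, Real.pi_pos]
        rw [div_le_iff₀ (lt_of_lt_of_le (by norm_num) hsq)]
        norm_num [Nat.factorial] at *; linarith
      · have hsq : 4.3 ≤ Real.sqrt (2 * Real.pi * (3 : ℕ)) := by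
          refine Real.le_sqrt_of_sq_le ?_
          push_cast; nlinarith [Real.pi_gt_d2, Real.pi_pos]
        rw [div_le_iff₀ (lt_of_lt_of_le (by norm_num) hsq)]
        norm_num [Nat.factorial] at *; linarith
    · refine le_max_of_le_right ?_
      have hk4 : (4 : ℝ) ≤ k := by exact_mod_cast h4
      have hsq : 5 ≤ Real.sqrt (2 * Real.pi * k) := by
        refine Real.le_sqrt_of_sq_le ?_
        nlinarith [Real.pi_gt_d2, Real.pi_pos]
      rw [div_le_iff₀ (by linarith)]
      have h0 : (0 : ℝ) ≤ 1.23 ^ k * k.factorial := by positivity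
      nlinarith
  · refine (exp_le_of_sum_range (b := 1.321) (by norm_num) (by norm_num) (by norm_num)).trans ?_
    linarith
  · have : Real.exp (3 / (4 * 2.2 * 1.23) + 2.2 ^ 3 / (4 * 1.23)) = Real.exp 0.8138 ^ 3 *
        Real.exp (3 / (4 * 2.2 * 1.23) + 2.2 ^ 3 / (4 * 1.23) - 3 * 0.8138) := by
      rw [← Real.exp_nat_mul, ← Real.exp_add]; congr 1; push_cast; ring
    have h0 : Real.exp (3 / (4 * 2.2 * 1.23) + 2.2 ^ 3 / (4 * 1.23) - 3 * 0.8138 : ℝ) ≤ 1 :=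
      Real.exp_le_one_iff.2 (by norm_num)
    have h1 : Real.exp 0.8138 ≤ 2.258 :=
      exp_le_of_sum_range (by norm_num) (by norm_num) (by norm_num)
    rw [this]
    calc _ ≤ (2.258 : ℝ) ^ 3 * 1 := by gcongr
      _ ≤ 11.55 := by norm_num

/-! ### The weights `r(h)` and the sums `∑ r(h) ^ (-1/lam)` -/

variable {α : ℝ} {γ : Finset ℕ → ℝ} {d : ℕ}

theorem korobovWeight_pos (hγ : ∀ u, 0 < γ u) (h : Fin d → ℤ) : 0 < korobovWeight α γ h := by
  refine mul_pos (inv_pos.2 (hγ _)) (prod_pos fun j hj => ?_)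
  have : h j ≠ 0 := (mem_filter.1 hj).2
  positivity

theorem korobovWeight_le_of_abs_le (hα : 0 ≤ α) (hγ : ∀ u, 0 < γ u) {h g : Fin d → ℤ}
    (h0 : ∀ j, g j = 0 ↔ h j = 0) (hle : ∀ j, |g j| ≤ |h j|) :
    korobovWeight α γ g ≤ korobovWeight α γ h := by
  have e : (univ.filter fun j => g j ≠ 0) = univ.filter fun j => h j ≠ 0 := by
    ext j; simp [h0 j]
  rw [korobovWeight, korobovWeight, freqSupport, freqSupport, e]
  refine mul_le_mul_of_nonneg_left (prod_le_prod (fun j _ => by positivity) fun j _ => ?_)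
    (inv_pos.2 (hγ _)).le
  refine Real.rpow_le_rpow (abs_nonneg _) ?_ hα
  exact_mod_cast hle j

theorem korobovWeight_neg (h : Fin d → ℤ) : korobovWeight α γ (-h) = korobovWeight α γ h := by
  simp [korobovWeight, freqSupport]

theorem korobovWeight_rpow (hγ : ∀ u, 0 < γ u) (lam : ℝ) (h : Fin d → ℤ) :
    korobovWeight α γ h ^ (-1 / lam) =
      γ (freqSupport h) ^ (1 / lam) * ∏ j, if h j ≠ 0 then (|h j| : ℝ) ^ (-(α / lam)) else 1 := by
  rw [korobovWeight, Real.mul_rpow (inv_pos.2 (hγ _)).le (prod_nonneg fun j _ => by positivity),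
    Real.inv_rpow (hγ _).le, ← Real.rpow_neg (hγ _).le, ← Real.finsetProd_rpow _ _
    (fun j _ => by positivity), prod_filter]
  congr 1
  · congr 1; ring
  · refine prod_congr rfl fun j _ => ?_
    split_ifs
    · rw [← Real.rpow_mul (by positivity)]; congr 1; ring
    · rfl

theorem sum_natCast_rpow_le_zeta {s : ℝ} (hs : 1 < s) (B : ℕ) :
    ∑ m ∈ Icc 1 B, (m : ℝ) ^ (-s) ≤ (riemannZeta (s : ℂ)).re := by
  have hsum : Summable fun n : ℕ => 1 / (n : ℝ) ^ s := Real.summable_one_div_nat_rpow.2 hs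
  have e : (riemannZeta (s : ℂ)).re = ∑' n : ℕ, 1 / (n : ℝ) ^ s := by
    rw [zeta_eq_tsum_one_div_nat_cpow (by simpa using hs)]
    have : ∀ n : ℕ, 1 / (n : ℂ) ^ (s : ℂ) = ((1 / (n : ℝ) ^ s : ℝ) : ℂ) := by
      intro n
      push_cast
      rw [Complex.ofReal_cpow (by positivity)]
      simp
    simp_rw [this]
    rw [← Complex.ofReal_tsum, Complex.ofReal_re]
  rw [e]
  refine le_trans (le_of_eq ?_) (hsum.sum_le_tsum (Icc 1 B) fun n _ => by positivity)
  refine sum_congr rfl fun m _ => ?_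
  rw [Real.rpow_neg (by positivity), one_div]

theorem sum_intCast_rpow_le_zeta {s : ℝ} (hs : 1 < s) (B : ℕ) :
    ∑ m ∈ (Icc (-(B : ℤ)) B).erase 0, (|m| : ℝ) ^ (-s) ≤ 2 * (riemannZeta (s : ℂ)).re := by
  have hsub : (Icc (-(B : ℤ)) B).erase 0 ⊆
      (Icc 1 B).image (fun m : ℕ => (m : ℤ)) ∪ (Icc 1 B).image (fun m : ℕ => -(m : ℤ)) := by
    intro m hm
    rw [mem_erase, mem_Icc] at hm
    simp only [mem_union, mem_image, mem_Icc]
    rcases Int.natAbs_eq m with h | h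
    · exact Or.inl ⟨m.natAbs, by omega, h.symm⟩
    · exact Or.inr ⟨m.natAbs, by omega, h.symm⟩
  have hnn : ∀ m : ℤ, 0 ≤ (|m| : ℝ) ^ (-s) := fun m => by positivity
  have hz := sum_natCast_rpow_le_zeta hs B
  calc _ ≤ ∑ m ∈ (Icc 1 B).image (fun m : ℕ => (m : ℤ)) ∪ (Icc 1 B).image (fun m : ℕ => -(m : ℤ)),
        (|m| : ℝ) ^ (-s) := sum_le_sum_of_subset_of_nonneg hsub fun m _ _ => hnn m
    _ ≤ ∑ m ∈ (Icc 1 B).image (fun m : ℕ => (m : ℤ)), (|m| : ℝ) ^ (-s) +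
        ∑ m ∈ (Icc 1 B).image (fun m : ℕ => -(m : ℤ)), (|m| : ℝ) ^ (-s) := by
        rw [← sum_union_inter]
        exact le_add_of_nonneg_right (sum_nonneg fun m _ => hnn m)
    _ = ∑ m ∈ Icc 1 B, (m : ℝ) ^ (-s) + ∑ m ∈ Icc 1 B, (m : ℝ) ^ (-s) := by
        rw [sum_image (by intro a _ b _ h; simpa using h),
          sum_image (by intro a _ b _ h; simpa using h)]
        simp
    _ ≤ _ := by linarith

/-- The part of `∑ r(h) ^ (-1/lam)` that comes from a finite set of frequencies with support `v`
is bounded by the term of `v` in the summability condition. -/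
theorem sum_korobovWeight_support_le (hγ : ∀ u, 0 < γ u) {lam : ℝ} (hlam : 0 < lam) (hlα : lam < α)
    (F : Finset (Fin d → ℤ)) (v : Finset (Fin d)) (hF : ∀ h ∈ F, (univ.filter fun j => h j ≠ 0) = v) :
    ∑ h ∈ F, korobovWeight α γ h ^ (-1 / lam) ≤ γ (v.map Fin.valEmbedding) ^ (1 / lam) *
      (2 * (riemannZeta ((α / lam : ℝ) : ℂ)).re) ^ v.card := by
  have hs : 1 < α / lam := (one_lt_div hlam).2 hlα
  set s := α / lam
  obtain ⟨B, hB⟩ : ∃ B : ℕ, ∀ h ∈ F, ∀ j, |h j| ≤ B := by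
    refine ⟨∑ h ∈ F, ∑ j, (h j).natAbs, fun h hh j => ?_⟩
    have h1 : (h j).natAbs ≤ ∑ j, (h j).natAbs :=
      single_le_sum (f := fun j => (h j).natAbs) (fun _ _ => Nat.zero_le _) (mem_univ j)
    have h2 : ∑ j, (h j).natAbs ≤ ∑ h ∈ F, ∑ j, (h j).natAbs :=
      single_le_sum (f := fun h : Fin d → ℤ => ∑ j, (h j).natAbs) (fun _ _ => Nat.zero_le _) hh
    rw [Int.abs_eq_natAbs]; exact_mod_cast h1.trans h2
  set box : Fin d → Finset ℤ := fun j => if j ∈ v then (Icc (-(B : ℤ)) B).erase 0 else {0} with hbox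
  set g : ℤ → ℝ := fun m => if m ≠ 0 then (|m| : ℝ) ^ (-s) else 1 with hg
  have hgn : ∀ m, 0 ≤ g m := fun m => by simp only [hg]; split_ifs <;> positivity
  have hmem : ∀ h ∈ F, ∀ j, h j ≠ 0 ↔ j ∈ v := fun h hh j => by simp [← hF h hh]
  have hsub : F ⊆ Fintype.piFinset box := by
    intro h hh
    rw [Fintype.mem_piFinset]
    intro j
    have h1 := hmem h hh j
    have h2 := abs_le.1 (hB h hh j)
    simp only [hbox]
    split_ifs with hj
    · rw [mem_erase, mem_Icc]; exact ⟨h1.2 hj, h2⟩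
    · rw [mem_singleton]; by_contra hc; exact hj (h1.1 hc)
  calc ∑ h ∈ F, korobovWeight α γ h ^ (-1 / lam)
      = ∑ h ∈ F, γ (v.map Fin.valEmbedding) ^ (1 / lam) * ∏ j, g (h j) := by
        refine sum_congr rfl fun h hh => ?_
        rw [korobovWeight_rpow hγ, freqSupport, hF h hh]
    _ = γ (v.map Fin.valEmbedding) ^ (1 / lam) * ∑ h ∈ F, ∏ j, g (h j) := by rw [mul_sum]
    _ ≤ γ (v.map Fin.valEmbedding) ^ (1 / lam) * ∑ h ∈ Fintype.piFinset box, ∏ j, g (h j) := by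
        have := (hγ (v.map Fin.valEmbedding)).le
        refine mul_le_mul_of_nonneg_left ?_ (Real.rpow_nonneg this _)
        exact sum_le_sum_of_subset_of_nonneg hsub fun h _ _ => prod_nonneg fun j _ => hgn _
    _ = γ (v.map Fin.valEmbedding) ^ (1 / lam) * ∏ j, ∑ m ∈ box j, g m := by
        rw [prod_univ_sum]
    _ ≤ γ (v.map Fin.valEmbedding) ^ (1 / lam) *
        ∏ j, if j ∈ v then 2 * (riemannZeta (s : ℂ)).re else 1 := by
        have := (hγ (v.map Fin.valEmbedding)).le
        refine mul_le_mul_of_nonneg_left (prod_le_prod (fun j _ => sum_nonneg fun m _ => hgn m)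
          fun j _ => ?_) (Real.rpow_nonneg this _)
        simp only [hbox]
        split_ifs with hj
        · refine le_trans (le_of_eq ?_) (sum_intCast_rpow_le_zeta hs B)
          refine sum_congr rfl fun m hm => ?_
          rw [hg]; simp only; rw [if_pos (mem_erase.1 hm).1]
        · simp [hg]
    _ = _ := by rw [prod_ite_mem, univ_inter, prod_const]

/-- The part of the series in the summability condition that belongs to the first `d`
coordinates. -/
def weightSum (d : ℕ) (α : ℝ) (γ : Finset ℕ → ℝ) (lam : ℝ) : ℝ :=
  ∑ v : Finset (Fin d) with v.Nonempty, γ (v.map Fin.valEmbedding) ^ (1 / lam) *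
    (2 * (riemannZeta ((α / lam : ℝ) : ℂ)).re) ^ v.card

theorem sum_korobovWeight_le (hγ : ∀ u, 0 < γ u) {lam : ℝ} (hlam : 0 < lam) (hlα : lam < α)
    (F : Finset {h : Fin d → ℤ // h ≠ 0}) :
    ∑ h ∈ F, korobovWeight α γ h.1 ^ (-1 / lam) ≤ weightSum d α γ lam := by
  refine (sum_map F (Function.Embedding.subtype _)
    fun h => korobovWeight α γ h ^ (-1 / lam)).symm.trans_le ?_
  rw [← sum_fiberwise_of_maps_to (t := {v : Finset (Fin d) | v.Nonempty})
    (g := fun h : Fin d → ℤ => univ.filter fun j => h j ≠ 0), weightSum]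
  · refine sum_le_sum fun v _ => sum_korobovWeight_support_le hγ hlam hlα _ v fun h hh => ?_
    exact (mem_filter.1 hh).2
  · intro h hh
    obtain ⟨⟨g, hg⟩, _, rfl⟩ := mem_map.1 hh
    obtain ⟨j, hj⟩ := Function.ne_iff.1 hg
    rw [mem_filter]
    exact ⟨mem_univ _, j, mem_filter.2 ⟨mem_univ _, hj⟩⟩

theorem summable_korobovWeight (hγ : ∀ u, 0 < γ u) {lam : ℝ} (hlam : 0 < lam) (hlα : lam < α) :
    Summable fun h : {h : Fin d → ℤ // h ≠ 0} => korobovWeight α γ h.1 ^ (-1 / lam) :=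
  summable_of_sum_le (fun _ => Real.rpow_nonneg (korobovWeight_pos hγ _).le _)
    (sum_korobovWeight_le hγ hlam hlα)

theorem muQuantity_le_tsum (hγ : ∀ u, 0 < γ u) {lam : ℝ} (hlam : 0 < lam) (hlα : lam < α)
    (hsum : Summable (weightTerm α γ lam)) : muQuantity d α γ lam ≤ ∑' u, weightTerm α γ lam u := by
  have hs : 1 < α / lam := (one_lt_div hlam).2 hlα
  have hz : 0 ≤ 2 * (riemannZeta ((α / lam : ℝ) : ℂ)).re := by
    have := sum_natCast_rpow_le_zeta hs 0
    simp at this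
    simpa using this
  have hnn : ∀ u, 0 ≤ weightTerm α γ lam u := fun u =>
    mul_nonneg (Real.rpow_nonneg (hγ _).le _) (pow_nonneg hz _)
  refine ((summable_korobovWeight hγ hlam hlα).tsum_le_of_sum_le
    (sum_korobovWeight_le hγ hlam hlα)).trans ?_
  set f : {v : Finset (Fin d) // v.Nonempty} → {u : Finset ℕ // u.Nonempty} :=
    fun v => ⟨v.1.map Fin.valEmbedding, v.2.map⟩ with hf
  have hfi : Function.Injective f := by
    intro v w h
    simp only [hf, Subtype.mk.injEq, map_inj] at h
    exact Subtype.ext h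
  have e : weightSum d α γ lam = ∑ u ∈ (univ.subtype fun v : Finset (Fin d) => v.Nonempty).map ⟨f, hfi⟩,
      weightTerm α γ lam u := by
    rw [sum_map, weightSum, ← sum_subtype_eq_sum_filter]
    simp [weightTerm, hf]
  rw [e]
  exact hsum.sum_le_tsum _ fun u _ => hnn u

/-! ### The position of a frequency in the order given by its weight -/

theorem finite_korobovWeight_le (hα : 0 < α) (hγ : ∀ u, 0 < γ u) (ρ : ℝ) :
    {h : Fin d → ℤ | h ≠ 0 ∧ korobovWeight α γ h ≤ ρ}.Finite := by
  rcases le_or_gt ρ 0 with hρ | hρ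
  · convert Set.finite_empty
    ext h
    simp only [Set.mem_ofPred_eq, Set.mem_empty_iff_false, iff_false, not_and, not_le]
    exact fun _ => hρ.trans_lt (korobovWeight_pos hγ h)
  have hsum := summable_korobovWeight (d := d) hγ (half_pos hα) (half_lt_self hα)
  have hfin : {h : {h : Fin d → ℤ // h ≠ 0} |
      ρ ^ (-1 / (α / 2)) ≤ korobovWeight α γ h.1 ^ (-1 / (α / 2))}.Finite := by
    have := hsum.tendsto_cofinite_zero.eventually_lt_const
      (Real.rpow_pos_of_pos hρ (-1 / (α / 2)))
    simpa [Filter.eventually_cofinite] using this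
  refine (hfin.image Subtype.val).subset fun h hh => ⟨⟨h, hh.1⟩, ?_, rfl⟩
  refine Real.rpow_le_rpow_of_nonpos (korobovWeight_pos hγ h) hh.2 ?_
  exact div_nonpos_of_nonpos_of_nonneg (by norm_num) (by positivity)

/-- The number of nonzero frequencies whose weight is at most that of `h`: the position of `h` when
the frequencies are ordered by weight, ties being counted in full. -/
def korobovIndex (α : ℝ) (γ : Finset ℕ → ℝ) {d : ℕ} (h : Fin d → ℤ) : ℕ :=
  {g : Fin d → ℤ | g ≠ 0 ∧ korobovWeight α γ g ≤ korobovWeight α γ h}.ncard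

theorem korobovIndex_neg (h : Fin d → ℤ) : korobovIndex α γ (-h) = korobovIndex α γ h := by
  simp only [korobovIndex, korobovWeight_neg]

/-- This inequality, for all `lam` at once, is what makes the choice of the generating vector
independent of `lam`. -/
theorem korobovIndex_mul_le (hα : 0 < α) (hγ : ∀ u, 0 < γ u) {lam : ℝ} (hlam : 0 < lam)
    (hlα : lam < α) (h : Fin d → ℤ) :
    korobovIndex α γ h * korobovWeight α γ h ^ (-1 / lam) ≤ muQuantity d α γ lam := by
  have hfin := finite_korobovWeight_le (d := d) hα hγ (korobovWeight α γ h)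
  have hne : ∀ g ∈ hfin.toFinset, g ≠ 0 := fun g hg => ((hfin.mem_toFinset).1 hg).1
  rw [korobovIndex, Set.ncard_eq_toFinset_card _ hfin, ← nsmul_eq_mul, ← sum_const, muQuantity]
  refine le_trans ?_ ((summable_korobovWeight hγ hlam hlα).sum_le_tsum
    (hfin.toFinset.subtype fun g => g ≠ 0) fun g _ => Real.rpow_nonneg (korobovWeight_pos hγ _).le _)
  rw [sum_subtype_of_mem (fun g => korobovWeight α γ g ^ (-1 / lam)) hne]
  refine sum_le_sum fun g hg => ?_
  refine Real.rpow_le_rpow_of_nonpos (korobovWeight_pos hγ g) ((hfin.mem_toFinset).1 hg).2 ?_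
  exact div_nonpos_of_nonpos_of_nonneg (by norm_num) hlam.le

/-- The multiples of `q` have density at most `1/q` in the order given by the weight: moving every
nonzero coordinate of a multiple of `q` by `e < q` towards zero keeps the support and does not
increase the weight, and different pairs (multiple of `q`, `e`) lead to different frequencies. -/
theorem mul_card_le_of_korobovIndex_le (hα : 0 < α) (hγ : ∀ u, 0 < γ u) {q : ℕ} {X : ℝ}
    (hX : 0 ≤ X) (S : Finset (Fin d → ℤ))
    (hS : ∀ h ∈ S, h ≠ 0 ∧ (∀ j, (q : ℤ) ∣ h j) ∧ (korobovIndex α γ h : ℝ) ≤ X) :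
    (q * #S : ℝ) ≤ X := by
  rcases S.eq_empty_or_nonempty with rfl | hne
  · simpa using hX
  obtain ⟨m, hm, hmax⟩ := exists_max_image S (korobovWeight α γ) hne
  refine le_trans ?_ (hS m hm).2.2
  have hfin := finite_korobovWeight_le (d := d) hα hγ (korobovWeight α γ m)
  have hcard : #(S ×ˢ range q) ≤ #hfin.toFinset := by
    have habs : ∀ h ∈ S, ∀ j, h j ≠ 0 → (q : ℤ) ≤ |h j| := fun h hh j hj =>
      Int.le_of_dvd (abs_pos.2 hj) ((dvd_abs _ _).2 ((hS h hh).2.1 j))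
    have hsign : ∀ h ∈ S, ∀ e < q, ∀ j, (h j - e * (h j).sign).sign = (h j).sign ∧
        |h j - e * (h j).sign| ≤ |h j| := by
      intro h hh e he j
      have he' : (e : ℤ) < q := by exact_mod_cast he
      rcases lt_trichotomy (h j) 0 with hj | hj | hj
      · have := habs h hh j hj.ne
        rw [abs_of_neg hj] at this ⊢
        rw [Int.sign_eq_neg_one_of_neg hj]
        refine ⟨Int.sign_eq_neg_one_of_neg (by omega), ?_⟩
        rw [abs_of_neg (by omega)]; omega
      · simp [hj]
      · have := habs h hh j hj.ne'
        rw [abs_of_pos hj] at this ⊢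
        rw [Int.sign_eq_one_of_pos hj]
        refine ⟨Int.sign_eq_one_of_pos (by omega), ?_⟩
        rw [abs_of_pos (by omega)]; omega
    refine card_le_card_of_injOn (fun p j => p.1 j - p.2 * (p.1 j).sign) ?_ ?_
    · rintro ⟨h, e⟩ hp
      simp only [coe_product, Set.mem_prod, mem_coe, mem_range] at hp
      have hs := hsign h hp.1 e hp.2
      have h0 : ∀ j, h j - e * (h j).sign = 0 ↔ h j = 0 := fun j => by
        rw [← Int.sign_eq_zero_iff_zero, (hs j).1, Int.sign_eq_zero_iff_zero]
      simp only [Set.Finite.coe_toFinset, Set.mem_ofPred_eq]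
      refine ⟨fun hz => (hS h hp.1).1 (funext fun j => (h0 j).1 (congrFun hz j)), ?_⟩
      exact (korobovWeight_le_of_abs_le hα.le hγ h0 fun j => (hs j).2).trans (hmax h hp.1)
    · rintro ⟨h, e⟩ hp ⟨g, f⟩ hp' heq
      simp only [coe_product, Set.mem_prod, mem_coe, mem_range] at hp hp'
      have hpt : ∀ j, h j - e * (h j).sign = g j - f * (g j).sign := fun j => congrFun heq j
      have hsg : ∀ j, (h j).sign = (g j).sign := fun j => by
        rw [← (hsign h hp.1 e hp.2 j).1, ← (hsign g hp'.1 f hp'.2 j).1, hpt j]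
      obtain ⟨j, hj⟩ := Function.ne_iff.1 (hS h hp.1).1
      have hef : e = f := by
        obtain ⟨a, ha⟩ := (hS h hp.1).2.1 j
        obtain ⟨b, hb⟩ := (hS g hp'.1).2.1 j
        have h1 := hpt j
        rw [← hsg j] at h1
        have hdvd : (q : ℤ) ∣ (e : ℤ) - f := by
          rcases lt_or_gt_of_ne (show h j ≠ 0 from hj) with hs | hs
          · rw [Int.sign_eq_neg_one_of_neg hs] at h1
            exact ⟨b - a, by rw [mul_sub, ← ha, ← hb]; linarith⟩
          · rw [Int.sign_eq_one_of_pos hs] at h1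
            exact ⟨a - b, by rw [mul_sub, ← ha, ← hb]; linarith⟩
        have hlt : |(e : ℤ) - f| < q := by rw [abs_lt]; omega
        have := Int.eq_zero_of_abs_lt_dvd hdvd hlt
        omega
      subst hef
      refine Prod.ext (funext fun j => ?_) rfl
      have := hpt j
      rw [hsg j] at this
      simpa using this
  rw [card_product, card_range] at hcard
  rw [korobovIndex, Set.ncard_eq_toFinset_card _ hfin, mul_comm]
  exact_mod_cast hcard

theorem finite_korobovIndex_le (hα : 0 < α) (hγ : ∀ u, 0 < γ u) (X : ℝ) :
    {h : Fin d → ℤ | h ≠ 0 ∧ (korobovIndex α γ h : ℝ) ≤ X}.Finite := by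
  by_contra hinf
  have hinf : Set.Infinite {h : Fin d → ℤ | h ≠ 0 ∧ (korobovIndex α γ h : ℝ) ≤ X} := hinf
  obtain ⟨S, hS, hc⟩ := hinf.exists_subset_card_eq (⌈|X|⌉₊ + 1)
  have := mul_card_le_of_korobovIndex_le (X := |X|) (q := 1) hα hγ (abs_nonneg X) S fun h hh =>
    ⟨(hS hh).1, fun j => by simp, (hS hh).2.trans (le_abs_self X)⟩
  rw [hc] at this
  push_cast at this
  linarith [Nat.le_ceil |X|]

/-! ### The choice of the generating vector -/

/-- The vectors with entries in `{0, …, p - 1}`. -/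
def residueBox (d p : ℕ) : Finset (Fin d → ℤ) := Fintype.piFinset fun _ => Ico 0 (p : ℤ)

theorem card_residueBox (d p : ℕ) : #(residueBox d p) = p ^ d := by
  simp [residueBox]

/-- A proportion of at most `1/p` of the residue vectors is orthogonal to `h` modulo `p`: moving
a coordinate `j` with `p ∤ h j` through all the residues leads to `p` times as many vectors. -/
theorem mul_card_filter_dvd_le {p : ℕ} (hp : p.Prime) {h : Fin d → ℤ}
    (hh : ¬ ∀ j, (p : ℤ) ∣ h j) :
    p * #{v ∈ residueBox d p | (p : ℤ) ∣ dotProduct h v} ≤ p ^ d := by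
  classical
  obtain ⟨j, hj⟩ := not_forall.1 hh
  have hp0 : (0 : ℤ) < p := by exact_mod_cast hp.pos
  rw [← card_residueBox, mul_comm, ← card_range p, ← card_product, card_range]
  refine card_le_card_of_injOn (fun x => Function.update x.1 j ((x.1 j + x.2) % p)) ?_ ?_
  · rintro ⟨v, t⟩ hx
    simp only [coe_product, Set.mem_prod, mem_coe, mem_filter, residueBox, Fintype.mem_piFinset] at hx ⊢
    intro i
    rcases eq_or_ne i j with rfl | hi
    · rw [Function.update_self, mem_Ico]
      exact ⟨Int.emod_nonneg _ hp0.ne', Int.emod_lt_of_pos _ hp0⟩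
    · rw [Function.update_of_ne hi]; exact hx.1.1 i
  · rintro ⟨v, t⟩ hx ⟨w, s⟩ hy heq
    simp only [coe_product, Set.mem_prod, mem_coe, mem_filter, residueBox, Fintype.mem_piFinset,
      mem_range, mem_Ico] at hx hy heq
    have hne : ∀ i, i ≠ j → v i = w i := fun i hi => by
      have := congrFun heq i
      simpa [Function.update_of_ne hi] using this
    have hsub : dotProduct h v - dotProduct h w = h j * (v j - w j) := by
      rw [← dotProduct_sub, dotProduct, sum_eq_single j]
      · simp
      · intro i _ hi; simp [hne i hi]
      · simp
    have hd : (p : ℤ) ∣ h j * (v j - w j) := hsub ▸ dvd_sub hx.1.2 hy.1.2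
    have hvw : v j = w j := by
      rcases (Nat.prime_iff_prime_int.1 hp).dvd_or_dvd hd with h1 | h1
      · exact absurd h1 hj
      · have hlt : |v j - w j| < p := by
          rw [abs_lt]; have := hx.1.1 j; have := hy.1.1 j; omega
        have := Int.eq_zero_of_abs_lt_dvd h1 hlt
        omega
    have hv : v = w := funext fun i => by
      rcases eq_or_ne i j with rfl | hi
      · exact hvw
      · exact hne i hi
    subst hv
    have h2 := congrFun heq j
    simp only [Function.update_self] at h2
    have h3 : (p : ℤ) ∣ (t : ℤ) - s := by
      have := Int.ModEq.dvd (show (v j + s) ≡ (v j + t) [ZMOD p] from h2.symm)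
      simpa using this
    have hlt : |(t : ℤ) - s| < p := by rw [abs_lt]; omega
    have := Int.eq_zero_of_abs_lt_dvd h3 hlt
    exact Prod.ext rfl (by simp only; omega)

open Classical in
/-- The residue vectors modulo `p` for which the dual lattice contains none of the frequencies of
index less than `n / 4`, except possibly multiples of `p`. -/
def goodVectors (α : ℝ) (γ : Finset ℕ → ℝ) (d n p : ℕ) : Finset (Fin d → ℤ) :=
  {v ∈ residueBox d p | ∀ h : Fin d → ℤ, h ≠ 0 → 4 * korobovIndex α γ h < n →
    (¬ ∀ j, (p : ℤ) ∣ h j) → ¬ (p : ℤ) ∣ dotProduct h v}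

theorem ne_neg_of_ne_zero {h : Fin d → ℤ} (hh : h ≠ 0) : h ≠ -h := by
  obtain ⟨j, hj⟩ := Function.ne_iff.1 hh
  intro he
  have := congrFun he j
  simp at this hj
  omega

/-- At least three quarters of the residue vectors are good.  A vector which is not good is
excluded by two frequencies `±h`, which gains a factor two. -/
theorem three_mul_le_card_goodVectors (hα : 0 < α) (hγ : ∀ u, 0 < γ u) {n p : ℕ} (hp : p.Prime)
    (hnp : n < 2 * p) : 3 * p ^ d ≤ 4 * #(goodVectors α γ d n p) := by
  classical
  have hfin := finite_korobovIndex_le (d := d) hα hγ (n / 4 : ℝ)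
  set S : Finset (Fin d → ℤ) := {h ∈ hfin.toFinset | ¬ ∀ j, (p : ℤ) ∣ h j} with hS
  have hScard : (#S : ℝ) ≤ n / 4 := by
    have := mul_card_le_of_korobovIndex_le (q := 1) hα hγ (X := (n / 4 : ℝ)) (by positivity) S
      fun h hh => by
        have := (hfin.mem_toFinset).1 (mem_filter.1 hh).1
        exact ⟨this.1, by simp, this.2⟩
    simpa using this
  set bad := residueBox d p \ goodVectors α γ d n p with hbad
  have htwo : ∀ v ∈ bad, 2 ≤ #{h ∈ S | (p : ℤ) ∣ dotProduct h v} := by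
    intro v hv
    rw [hbad, mem_sdiff] at hv
    have h2 := hv.2
    simp only [goodVectors, mem_filter, hv.1, true_and] at h2
    push Not at h2
    obtain ⟨h, h0, hR, hp', hdv⟩ := h2
    have hR' : (korobovIndex α γ h : ℝ) ≤ n / 4 := by
      rw [le_div_iff₀ (by norm_num)]
      have : korobovIndex α γ h * 4 ≤ n := by omega
      exact_mod_cast this
    rw [← card_pair (ne_neg_of_ne_zero h0)]
    refine card_le_card fun g hg => ?_
    rw [mem_filter, hS, mem_filter, hfin.mem_toFinset]
    rcases mem_insert.1 hg with rfl | hg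
    · exact ⟨⟨⟨h0, hR'⟩, not_forall.2 hp'⟩, hdv⟩
    · rw [mem_singleton] at hg
      subst hg
      refine ⟨⟨⟨neg_ne_zero.2 h0, by rwa [korobovIndex_neg]⟩, ?_⟩, ?_⟩
      · simpa using hp'
      · simpa [neg_dotProduct] using hdv
  have hcount : p * (2 * #bad) ≤ #S * p ^ d := by
    calc p * (2 * #bad) ≤ p * ∑ v ∈ bad, #{h ∈ S | (p : ℤ) ∣ dotProduct h v} := by
          gcongr
          rw [mul_comm, ← smul_eq_mul, ← sum_const]
          exact sum_le_sum htwo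
      _ = p * ∑ h ∈ S, #{v ∈ bad | (p : ℤ) ∣ dotProduct h v} := by
          congr 1
          exact (sum_card_bipartiteAbove_eq_sum_card_bipartiteBelow
            (s := S) (t := bad) (fun h v => (p : ℤ) ∣ dotProduct h v)).symm
      _ = ∑ h ∈ S, p * #{v ∈ bad | (p : ℤ) ∣ dotProduct h v} := mul_sum _ _ _
      _ ≤ ∑ h ∈ S, p ^ d := by
          refine sum_le_sum fun h hh => le_trans ?_ (mul_card_filter_dvd_le hp (mem_filter.1 hh).2)
          gcongr
          exact sdiff_subset
      _ = #S * p ^ d := by rw [sum_const, smul_eq_mul]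
  have hsub : goodVectors α γ d n p ⊆ residueBox d p := filter_subset _ _
  have hsum : #bad + #(goodVectors α γ d n p) = p ^ d := by
    rw [← card_residueBox d p]; exact card_sdiff_add_card_eq_card hsub
  have h1 : (p * (2 * #bad) : ℝ) ≤ #S * p ^ d := by exact_mod_cast hcount
  have h2 : (n : ℝ) < 2 * p := by exact_mod_cast hnp
  have h3 : (p * (4 * #bad) : ℝ) ≤ p * p ^ d := by
    have : (#S : ℝ) * p ^ d ≤ (p / 2) * p ^ d := by gcongr; linarith
    linarith
  have h4 : (4 * #bad : ℝ) ≤ p ^ d := le_of_mul_le_mul_left h3 (by exact_mod_cast hp.pos)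
  have h5 : 4 * #bad ≤ p ^ d := by exact_mod_cast h4
  omega

theorem card_goodVectors_filter_dvd_le (hα : 0 < α) (hγ : ∀ u, 0 < γ u) {n p : ℕ} (hp : p.Prime)
    (hn : 0 < n) (hnp : n < 2 * p) {h : Fin d → ℤ} (hh : ¬ ∀ j, (p : ℤ) ∣ h j) :
    (#{v ∈ goodVectors α γ d n p | (p : ℤ) ∣ dotProduct h v} : ℝ) ≤
      8 / (3 * n) * #(goodVectors α γ d n p) := by
  classical
  have h1 : p * #{v ∈ goodVectors α γ d n p | (p : ℤ) ∣ dotProduct h v} ≤ p ^ d := by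
    refine le_trans ?_ (mul_card_filter_dvd_le hp hh)
    gcongr
    exact filter_subset _ _
  have h2 := three_mul_le_card_goodVectors (d := d) hα hγ hp hnp
  have h3 : 3 * n * #{v ∈ goodVectors α γ d n p | (p : ℤ) ∣ dotProduct h v} ≤
      8 * #(goodVectors α γ d n p) := by
    have h4 := Nat.mul_le_mul_right (#{v ∈ goodVectors α γ d n p | (p : ℤ) ∣ dotProduct h v}) hnp.le
    nlinarith
  have h3' : (3 * n * #{v ∈ goodVectors α γ d n p | (p : ℤ) ∣ dotProduct h v} : ℝ) ≤
      8 * #(goodVectors α γ d n p) := by exact_mod_cast h3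
  rw [div_mul_eq_mul_div, le_div_iff₀ (by positivity)]
  linarith

variable {P : Finset ℕ}

/-- The proportion of the families of good vectors such that all the primes in `T` divide `h · z`.
The primes outside `T` impose no condition, those in `T` act independently. -/
theorem card_filter_forall_dvd_le (hα : 0 < α) (hγ : ∀ u, 0 < γ u) {n : ℕ} (hn : 0 < n)
    (hP : ∀ p ∈ P, p.Prime ∧ n < 2 * p) (T : Finset P) (h : Fin d → ℤ) :
    (#{ω ∈ Fintype.piFinset fun p : P => goodVectors α γ d n p |
        ∀ p ∈ T, ((p : ℕ) : ℤ) ∣ dotProduct h (ω p)} : ℝ) ≤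
      #(Fintype.piFinset fun p : P => goodVectors α γ d n p) *
        ∏ p ∈ T, ((if ∀ j, ((p : ℕ) : ℤ) ∣ h j then 1 else 0) + 8 / (3 * n) : ℝ) := by
  classical
  have e : {ω ∈ Fintype.piFinset fun p : P => goodVectors α γ d n p |
        ∀ p ∈ T, ((p : ℕ) : ℤ) ∣ dotProduct h (ω p)} =
      Fintype.piFinset fun p : P => if p ∈ T then
        {v ∈ goodVectors α γ d n p | ((p : ℕ) : ℤ) ∣ dotProduct h v} else goodVectors α γ d n p := by
    ext ω
    simp only [mem_filter, Fintype.mem_piFinset]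
    constructor
    · rintro ⟨h1, h2⟩ p
      split_ifs with hp
      · exact mem_filter.2 ⟨h1 p, h2 p hp⟩
      · exact h1 p
    · intro h1
      refine ⟨fun p => ?_, fun p hp => ?_⟩
      · have := h1 p
        split_ifs at this
        · exact (mem_filter.1 this).1
        · exact this
      · have := h1 p
        rw [if_pos hp] at this
        exact (mem_filter.1 this).2
  rw [e, Fintype.card_piFinset, Fintype.card_piFinset, ← Fintype.prod_ite_mem T, Nat.cast_prod,
    Nat.cast_prod, ← prod_mul_distrib]
  refine prod_le_prod (fun p _ => by positivity) fun p _ => ?_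
  split_ifs with hpT hd
  · have : (#{v ∈ goodVectors α γ d n p | ((p : ℕ) : ℤ) ∣ dotProduct h v} : ℝ) ≤
        #(goodVectors α γ d n p) := by exact_mod_cast card_filter_le _ _
    have h8 : (0 : ℝ) ≤ #(goodVectors α γ d n p) * (8 / (3 * n)) := by positivity
    linarith
  · have := card_goodVectors_filter_dvd_le hα hγ (hP p p.2).1 hn (hP p p.2).2 hd
    linarith
  · simp

/-- The expected number of frequencies of index less than `G / 4` such that all the primes in `T`
divide `h · z`.  Expanding the product in `card_filter_forall_dvd_le` over the set of those
primes in `T` that divide `h`, the density of the multiples of their product comes in. -/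
theorem sum_prod_le (hα : 0 < α) (hγ : ∀ u, 0 < γ u) {n : ℕ} (hn : 0 < n)
    (hP : ∀ p ∈ P, p.Prime ∧ n < 2 * p) (T : Finset P) {G : ℝ} (hG : 0 ≤ G)
    (F : Finset (Fin d → ℤ)) (hF : ∀ h ∈ F, h ≠ 0 ∧ 4 * (korobovIndex α γ h : ℝ) ≤ G) :
    ∑ h ∈ F, ∏ p ∈ T, ((if ∀ j, ((p : ℕ) : ℤ) ∣ h j then 1 else 0) + 8 / (3 * n) : ℝ) ≤
      G / 4 * (14 / (3 * n)) ^ #T := by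
  classical
  have hn' : (0 : ℝ) < n := by exact_mod_cast hn
  have hD : ∀ D ⊆ T, ∑ h ∈ F, ∏ p ∈ D, (if ∀ j, ((p : ℕ) : ℤ) ∣ h j then 1 else 0 : ℝ) ≤
      G / 4 * ∏ p ∈ D, (1 / (p : ℕ) : ℝ) := by
    intro D _
    have hpos : 0 < ∏ p ∈ D, (p : ℕ) := prod_pos fun p _ => (hP p p.2).1.pos
    have h1 : ∀ h ∈ F, ∏ p ∈ D, (if ∀ j, ((p : ℕ) : ℤ) ∣ h j then 1 else 0 : ℝ) ≤
        if ∀ j, ((∏ p ∈ D, (p : ℕ) : ℕ) : ℤ) ∣ h j then 1 else 0 := by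
      intro h _
      by_cases hall : ∀ p ∈ D, ∀ j, ((p : ℕ) : ℤ) ∣ h j
      · rw [if_pos, prod_congr rfl fun p hp => if_pos (hall p hp)]
        · simp
        · intro j
          rw [Int.natCast_dvd]
          refine Finset.prod_dvd_of_isRelPrime ?_ fun p hp => Int.natCast_dvd.1 (hall p hp j)
          intro p _ q _ hpq
          exact Nat.coprime_iff_isRelPrime.1 ((Nat.coprime_primes (hP p p.2).1 (hP q q.2).1).2
            fun hc => hpq (Subtype.ext hc))
      · push Not at hall
        obtain ⟨p, hp, hj⟩ := hall
        rw [prod_eq_zero hp (if_neg (not_forall.2 hj))]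
        split_ifs <;> norm_num
    refine (sum_le_sum h1).trans ?_
    rw [← sum_filter, sum_const, nsmul_eq_mul, mul_one]
    have h2 := mul_card_le_of_korobovIndex_le (q := ∏ p ∈ D, (p : ℕ)) hα hγ (X := G / 4)
      (by positivity) {h ∈ F | ∀ j, ((∏ p ∈ D, (p : ℕ) : ℕ) : ℤ) ∣ h j} fun h hh => by
        rw [mem_filter] at hh
        refine ⟨(hF h hh.1).1, hh.2, ?_⟩
        linarith [(hF h hh.1).2]
    have h3 : ∏ p ∈ D, (1 / (p : ℕ) : ℝ) = 1 / ((∏ p ∈ D, (p : ℕ) : ℕ) : ℝ) := by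
      rw [prod_div_distrib]; simp
    rw [h3, mul_one_div, le_div_iff₀ (by exact_mod_cast hpos), mul_comm]
    exact h2
  simp_rw [prod_add]
  rw [sum_comm]
  calc _ ≤ ∑ D ∈ T.powerset, (G / 4 * ∏ p ∈ D, (1 / (p : ℕ) : ℝ)) * ∏ p ∈ T \ D, (8 / (3 * n) : ℝ) := by
        refine sum_le_sum fun D hDT => ?_
        rw [← sum_mul]
        exact mul_le_mul_of_nonneg_right (hD D (mem_powerset.1 hDT)) (by positivity)
    _ = G / 4 * ∏ p ∈ T, ((1 / (p : ℕ) : ℝ) + 8 / (3 * n)) := by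
        rw [prod_add, mul_sum]
        exact sum_congr rfl fun D _ => by ring
    _ ≤ G / 4 * ∏ p ∈ T, (14 / (3 * n) : ℝ) := by
        refine mul_le_mul_of_nonneg_left (prod_le_prod (fun p _ => by positivity) fun p _ => ?_)
          (by positivity)
        have h1 : (n : ℝ) ≤ 2 * (p : ℕ) := by exact_mod_cast (hP p p.2).2.le
        have hp0 : (0 : ℝ) < (p : ℕ) := by exact_mod_cast (hP p p.2).1.pos
        have h2 : (1 / (p : ℕ) : ℝ) ≤ 2 / n := by
          rw [div_le_div_iff₀ hp0 hn']; linarith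
        have h3 : (14 / (3 * n) : ℝ) = 2 / n + 8 / (3 * n) := by field_simp; norm_num
        linarith
    _ = _ := by rw [prod_const]

/-- The probabilistic argument: if the expected number of bad frequencies is less than two, then
some family of good vectors has no bad frequency at all, bad frequencies coming in pairs `±h`. -/
theorem exists_family (hα : 0 < α) (hγ : ∀ u, 0 < γ u) {n : ℕ} (hn : 0 < n)
    (hP : ∀ p ∈ P, p.Prime ∧ n < 2 * p) {H : ℕ → ℝ}
    (hsum : ∑ k ∈ range (#P + 1), (if 1 ≤ k ∧ (n : ℝ) < H k then
      H k * (14 * #P / (3 * n) : ℝ) ^ k / k.factorial else 0) < 8) :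
    ∃ ω ∈ Fintype.piFinset fun p : P => goodVectors α γ d n p, ∀ h : Fin d → ℤ, h ≠ 0 →
      ∀ T : Finset P, T.Nonempty → (n : ℝ) < H #T → 4 * (korobovIndex α γ h : ℝ) < H #T →
        ∃ p ∈ T, ¬ ((p : ℕ) : ℤ) ∣ dotProduct h (ω p) := by
  classical
  have hn' : (0 : ℝ) < n := by exact_mod_cast hn
  set Ω := Fintype.piFinset fun p : P => goodVectors α γ d n p with hΩ
  have hΩne : 0 < #Ω := by
    rw [hΩ, Fintype.card_piFinset]
    refine prod_pos fun p _ => ?_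
    have h1 := three_mul_le_card_goodVectors (d := d) hα hγ (hP p p.2).1 (hP p p.2).2
    have h2 : 0 < (p : ℕ) ^ d := pow_pos (hP p p.2).1.pos d
    omega
  set 𝒯 : Finset (Finset P) := {T | T.Nonempty ∧ (n : ℝ) < H #T} with h𝒯
  have hfin : ∀ T : Finset P, {h : Fin d → ℤ | h ≠ 0 ∧ 4 * (korobovIndex α γ h : ℝ) < H #T}.Finite :=
    fun T => (finite_korobovIndex_le hα hγ (H #T / 4)).subset fun h hh =>
      ⟨hh.1, by rw [le_div_iff₀ (by norm_num)]; linarith [hh.2]⟩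
  set B : (P → Fin d → ℤ) → Finset (Fin d → ℤ) := fun ω => 𝒯.biUnion fun T =>
    {h ∈ (hfin T).toFinset | ∀ p ∈ T, ((p : ℕ) : ℤ) ∣ dotProduct h (ω p)} with hB
  have hmemB : ∀ ω h, h ∈ B ω ↔ ∃ T : Finset P, (T.Nonempty ∧ (n : ℝ) < H #T) ∧
      (h ≠ 0 ∧ 4 * (korobovIndex α γ h : ℝ) < H #T) ∧
      ∀ p ∈ T, ((p : ℕ) : ℤ) ∣ dotProduct h (ω p) := by
    intro ω h
    simp only [hB, h𝒯, mem_biUnion, mem_filter, mem_univ, true_and, Set.Finite.mem_toFinset,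
      Set.mem_ofPred_eq]
  have hexp : (∑ ω ∈ Ω, #(B ω) : ℝ) < ∑ ω ∈ Ω, (2 : ℝ) := by
    have hT : ∀ T ∈ 𝒯, (∑ ω ∈ Ω,
        (#{h ∈ (hfin T).toFinset | ∀ p ∈ T, ((p : ℕ) : ℤ) ∣ dotProduct h (ω p)} : ℝ)) ≤
        #Ω * (H #T / 4 * (14 / (3 * n)) ^ #T) := by
      intro T hT
      have hH : 0 ≤ H #T := hn'.le.trans (mem_filter.1 hT).2.2.le
      have hswap := sum_card_bipartiteAbove_eq_sum_card_bipartiteBelow (s := Ω)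
        (t := (hfin T).toFinset) (fun ω h => ∀ p ∈ T, ((p : ℕ) : ℤ) ∣ dotProduct h (ω p))
      have hswap' : (∑ ω ∈ Ω,
          (#{h ∈ (hfin T).toFinset | ∀ p ∈ T, ((p : ℕ) : ℤ) ∣ dotProduct h (ω p)} : ℝ)) =
          ∑ h ∈ (hfin T).toFinset,
          (#{ω ∈ Ω | ∀ p ∈ T, ((p : ℕ) : ℤ) ∣ dotProduct h (ω p)} : ℝ) := by
        exact_mod_cast hswap
      rw [hswap']
      refine (sum_le_sum fun h _ => card_filter_forall_dvd_le hα hγ hn hP T h).trans ?_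
      rw [← mul_sum]
      gcongr
      refine sum_prod_le hα hγ hn hP T hH _ fun h hh => ?_
      have := ((hfin T).mem_toFinset).1 hh
      exact ⟨this.1, this.2.le⟩
    have hcardB : ∀ ω ∈ Ω, (#(B ω) : ℝ) ≤ ∑ T ∈ 𝒯,
        (#{h ∈ (hfin T).toFinset | ∀ p ∈ T, ((p : ℕ) : ℤ) ∣ dotProduct h (ω p)} : ℝ) := by
      intro ω _
      have := card_biUnion_le (s := 𝒯) (t := fun T =>
        {h ∈ (hfin T).toFinset | ∀ p ∈ T, ((p : ℕ) : ℤ) ∣ dotProduct h (ω p)})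
      rw [← Nat.cast_sum]
      exact Nat.cast_le.2 this
    set f : ℕ → ℝ := fun k => if 1 ≤ k ∧ (n : ℝ) < H k then H k / 4 * (14 / (3 * n)) ^ k else 0
      with hf
    have hfnn : ∀ k, 0 ≤ f k := by
      intro k
      simp only [hf]
      split_ifs with hk
      · have := hn'.le.trans hk.2.le
        positivity
      · exact le_rfl
    calc (∑ ω ∈ Ω, #(B ω) : ℝ) ≤ ∑ ω ∈ Ω, ∑ T ∈ 𝒯,
        (#{h ∈ (hfin T).toFinset | ∀ p ∈ T, ((p : ℕ) : ℤ) ∣ dotProduct h (ω p)} : ℝ) :=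
          sum_le_sum hcardB
      _ = ∑ T ∈ 𝒯, ∑ ω ∈ Ω,
        (#{h ∈ (hfin T).toFinset | ∀ p ∈ T, ((p : ℕ) : ℤ) ∣ dotProduct h (ω p)} : ℝ) := sum_comm
      _ ≤ ∑ T ∈ 𝒯, #Ω * (H #T / 4 * (14 / (3 * n)) ^ #T) := sum_le_sum hT
      _ = #Ω * ∑ T ∈ (univ : Finset P).powerset, f #T := by
          rw [← mul_sum, h𝒯, sum_filter, powerset_univ]
          congr 1
          refine sum_congr rfl fun T _ => ?_
          simp only [hf, Nat.one_le_iff_ne_zero, ← card_pos, Nat.pos_iff_ne_zero]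
      _ = #Ω * ∑ k ∈ range (#P + 1), (#P).choose k * f k := by
          rw [sum_powerset_apply_card, card_univ, Fintype.card_coe]
          simp
      _ ≤ #Ω * ∑ k ∈ range (#P + 1), 1 / 4 * (if 1 ≤ k ∧ (n : ℝ) < H k then
            H k * (14 * #P / (3 * n) : ℝ) ^ k / k.factorial else 0) := by
          refine mul_le_mul_of_nonneg_left (sum_le_sum fun k _ => ?_) (Nat.cast_nonneg _)
          have hc : ((#P).choose k : ℝ) ≤ (#P : ℝ) ^ k / k.factorial := Nat.choose_le_pow_div k #P
          refine (mul_le_mul_of_nonneg_right hc (hfnn k)).trans (le_of_eq ?_)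
          simp only [hf]
          split_ifs
          · rw [show (14 * #P / (3 * n) : ℝ) = #P * (14 / (3 * n)) by ring, mul_pow]; ring
          · simp
      _ < #Ω * 2 := by
          rw [← mul_sum]
          have : (0 : ℝ) < #Ω := by exact_mod_cast hΩne
          gcongr
          linarith
      _ = ∑ ω ∈ Ω, (2 : ℝ) := by rw [sum_const, nsmul_eq_mul]
  obtain ⟨ω, hω, hlt⟩ := exists_lt_of_sum_lt hexp
  refine ⟨ω, hω, fun h h0 T hTne hnT hhT => ?_⟩
  by_contra hcon
  push Not at hcon
  have hmem : ∀ g ∈ ({h, -h} : Finset (Fin d → ℤ)), g ∈ B ω := by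
    intro g hg
    rw [hmemB]
    refine ⟨T, ⟨hTne, hnT⟩, ?_⟩
    rcases mem_insert.1 hg with rfl | hg
    · exact ⟨⟨h0, hhT⟩, hcon⟩
    · rw [mem_singleton] at hg
      subst hg
      refine ⟨⟨neg_ne_zero.2 h0, by rwa [korobovIndex_neg]⟩, fun p hp => ?_⟩
      rw [neg_dotProduct, dvd_neg]
      exact hcon p hp
  have h2 := card_le_card (show ({h, -h} : Finset (Fin d → ℤ)) ⊆ B ω from hmem)
  rw [card_pair (ne_neg_of_ne_zero h0)] at h2
  have h2' : (2 : ℝ) ≤ #(B ω) := by exact_mod_cast h2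
  linarith

/-- The number of primes `p` in `P` such that the frequency `h` belongs to the dual lattice of the
rule with `p` points and generating vector `z`. -/
def dualCount (P : Finset ℕ) (z h : Fin d → ℤ) : ℕ :=
  #(P.filter fun p : ℕ => (p : ℤ) ∣ dotProduct h z)

/-- The generating vector, obtained from a family of good vectors by the Chinese remainder
theorem. -/
theorem exists_generatingVector (hα : 0 < α) (hγ : ∀ u, 0 < γ u) {n : ℕ} (hn : 0 < n)
    (hP : ∀ p ∈ P, p.Prime ∧ n < 2 * p) {H : ℕ → ℝ}
    (hsum : ∑ k ∈ range (#P + 1), (if 1 ≤ k ∧ (n : ℝ) < H k then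
      H k * (14 * #P / (3 * n) : ℝ) ^ k / k.factorial else 0) < 8) :
    ∃ z : Fin d → ℤ, (∀ j, 0 ≤ z j ∧ z j < ((∏ p ∈ P, p : ℕ) : ℤ)) ∧
      ∀ h : Fin d → ℤ, h ≠ 0 → 1 ≤ dualCount P z h →
        n ≤ 4 * (korobovIndex α γ h : ℝ) ∧
        H (dualCount P z h) ≤ 4 * (korobovIndex α γ h : ℝ) := by
  classical
  obtain ⟨ω, hω, hbad⟩ := exists_family (d := d) hα hγ hn hP hsum
  have hpos : ∀ p ∈ P, p ≠ 0 := fun p hp => (hP p hp).1.ne_zero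
  have hcop : Set.Pairwise (P : Set ℕ) (Function.onFun Nat.Coprime fun p => p) := fun p hp q hq hpq =>
    (Nat.coprime_primes (hP p hp).1 (hP q hq).1).2 hpq
  set a : Fin d → ℕ → ℕ := fun j p => if hp : p ∈ P then (ω ⟨p, hp⟩ j).toNat else 0 with ha
  set z : Fin d → ℕ := fun j => Nat.chineseRemainderOfFinset (a j) (fun p => p) P hpos hcop with hz
  have hzmod : ∀ p : P, ∀ j, ((p : ℕ) : ℤ) ∣ (z j : ℤ) - ω p j := by
    intro p j
    have h1 : z j ≡ a j p [MOD p] :=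
      (Nat.chineseRemainderOfFinset (a j) (fun p => p) P hpos hcop).2 p p.2
    have h2 : (a j p : ℤ) = ω p j := by
      have hg : ω p ∈ goodVectors α γ d n p := Fintype.mem_piFinset.1 hω p
      have hb := Fintype.mem_piFinset.1 (mem_filter.1 hg).1 j
      rw [mem_Ico] at hb
      simp only [ha, p.2, dif_pos]
      exact Int.toNat_of_nonneg hb.1
    rw [← h2]
    exact (Nat.modEq_iff_dvd.1 h1.symm)
  have hdvd : ∀ (p : P) (h : Fin d → ℤ), ((p : ℕ) : ℤ) ∣ dotProduct h (fun j => (z j : ℤ)) ↔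
      ((p : ℕ) : ℤ) ∣ dotProduct h (ω p) := by
    intro p h
    have : ((p : ℕ) : ℤ) ∣ dotProduct h (fun j => (z j : ℤ)) - dotProduct h (ω p) := by
      rw [← dotProduct_sub]
      exact dvd_sum fun j _ => Dvd.dvd.mul_left (hzmod p j) _
    exact (dvd_iff_dvd_of_dvd_sub this)
  refine ⟨fun j => z j, fun j => ⟨Int.natCast_nonneg _, ?_⟩, fun h h0 hk => ?_⟩
  · exact Int.ofNat_lt.2 (Nat.chineseRemainderOfFinset_lt_prod (a j) (fun p => p) hpos hcop)
  · have hnR : (n : ℝ) ≤ 4 * (korobovIndex α γ h : ℝ) := by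
      obtain ⟨p, hp⟩ := card_pos.1 hk
      rw [mem_filter] at hp
      by_cases hph : ∀ j, (p : ℤ) ∣ h j
      · have h1 := mul_card_le_of_korobovIndex_le (q := p) hα hγ (X := korobovIndex α γ h)
          (by positivity) {h} fun g hg => by
            rw [mem_singleton] at hg; subst hg; exact ⟨h0, hph, le_rfl⟩
        rw [card_singleton] at h1
        have h2 : (n : ℝ) < 2 * p := by exact_mod_cast (hP p hp.1).2
        push_cast at h1
        linarith
      · by_contra hcon
        rw [not_le] at hcon
        have hg : ω ⟨p, hp.1⟩ ∈ goodVectors α γ d n p := Fintype.mem_piFinset.1 hω ⟨p, hp.1⟩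
        refine (mem_filter.1 hg).2 h h0 (by exact_mod_cast hcon) hph ?_
        exact (hdvd ⟨p, hp.1⟩ h).1 hp.2
    refine ⟨hnR, ?_⟩
    by_contra hcon
    rw [not_le] at hcon
    set T : Finset P := P.attach.filter fun p => ((p : ℕ) : ℤ) ∣ dotProduct h (fun j => (z j : ℤ))
      with hT
    have hTc : #T = dualCount P (fun j => (z j : ℤ)) h := by
      rw [dualCount, ← card_map (Function.Embedding.subtype _)]
      congr 1
      ext p
      simp [hT, and_comm]
    rw [← hTc] at hcon hk
    obtain ⟨p, hp, hnd⟩ := hbad h h0 T (card_pos.1 hk) (hnR.trans_lt hcon) hcon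
    exact hnd ((hdvd p h).1 (mem_filter.1 hp).2)

/-! ### The mean square error in terms of Fourier coefficients -/

instance : IsProbabilityMeasure (torusMeasure d) := by
  unfold torusMeasure; infer_instance

instance : (torusMeasure d).IsAddLeftInvariant := by
  unfold torusMeasure; infer_instance

/-- Parseval's identity. -/
theorem lintegral_enorm_sq_eq_tsum {g : UnitAddTorus (Fin d) → ℂ} (hg : MemLp g 2 (torusMeasure d)) :
    ∫⁻ x, ‖g x‖ₑ ^ 2 ∂torusMeasure d = ∑' h, ‖UnitAddTorus.mFourierCoeff g h‖ₑ ^ 2 := by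
  have hs : HasSum (fun h => ‖UnitAddTorus.mFourierCoeff (hg.toLp g) h‖ ^ 2)
      (∫ x, ‖hg.toLp g x‖ ^ 2 ∂torusMeasure d) :=
    UnitAddTorus.hasSum_sq_mFourierCoeff (d := Fin d) (hg.toLp g)
  have hae := hg.coeFn_toLp
  have h1 : ∀ h, UnitAddTorus.mFourierCoeff (hg.toLp g) h = UnitAddTorus.mFourierCoeff g h := by
    intro h
    refine integral_congr_ae ?_
    change (fun t => _) =ᵐ[torusMeasure d] fun t => _
    filter_upwards [hae] with x hx
    rw [hx]
  have h2 : ∫ x, ‖hg.toLp g x‖ ^ 2 ∂torusMeasure d = ∫ x, ‖g x‖ ^ 2 ∂torusMeasure d := by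
    refine integral_congr_ae ?_
    filter_upwards [hae] with x hx
    rw [hx]
  simp_rw [h1, h2] at hs
  have hint : Integrable (fun x => ‖g x‖ ^ 2) (torusMeasure d) := hg.norm.integrable_sq
  have e : ∀ c : ℂ, ‖c‖ₑ ^ 2 = ENNReal.ofReal (‖c‖ ^ 2) := fun c => by
    rw [ENNReal.ofReal_pow (norm_nonneg _), ofReal_norm]
  simp_rw [e]
  rw [← ofReal_integral_eq_lintegral_ofReal hint (ae_of_all _ fun x => by positivity),
    ← ENNReal.ofReal_tsum_of_nonneg (fun h => by positivity) hs.summable, hs.tsum_eq]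

theorem memLp_translate {f : UnitAddTorus (Fin d) → ℂ} (hf : MemLp f 2 (torusMeasure d))
    (a : UnitAddTorus (Fin d)) : MemLp (fun x => f (a + x)) 2 (torusMeasure d) :=
  hf.comp_measurePreserving (measurePreserving_add_left (torusMeasure d) a)

theorem mFourierCoeff_translate (f : UnitAddTorus (Fin d) → ℂ) (a : UnitAddTorus (Fin d))
    (h : Fin d → ℤ) : UnitAddTorus.mFourierCoeff (fun x => f (a + x)) h =
      UnitAddTorus.mFourier h a * UnitAddTorus.mFourierCoeff f h := by
  have hmul : ∀ x y : UnitAddTorus (Fin d), UnitAddTorus.mFourier (-h) (x + y) =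
      UnitAddTorus.mFourier (-h) x * UnitAddTorus.mFourier (-h) y := by
    intro x y
    simp only [UnitAddTorus.mFourier, ContinuousMap.coe_mk, Pi.add_apply, ← prod_mul_distrib]
    refine prod_congr rfl fun j _ => ?_
    simp only [fourier_apply, smul_add, AddCircle.toCircle_add, Circle.coe_mul]
  have hinv : UnitAddTorus.mFourier h a * UnitAddTorus.mFourier (-h) a = 1 := by
    rw [← UnitAddTorus.mFourier_add, add_neg_cancel, UnitAddTorus.mFourier_zero]; rfl
  change ∫ t, UnitAddTorus.mFourier (-h) t • f (a + t) ∂torusMeasure d =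
    UnitAddTorus.mFourier h a * ∫ t, UnitAddTorus.mFourier (-h) t • f t ∂torusMeasure d
  rw [← integral_add_left_eq_self (μ := torusMeasure d)
    (fun t => UnitAddTorus.mFourier (-h) t • f t) a, ← integral_const_mul]
  refine integral_congr_ae (ae_of_all _ fun t => ?_)
  simp only [smul_eq_mul, hmul]
  rw [← mul_assoc, ← mul_assoc, hinv, one_mul]

/-- The `k`-th point of the lattice rule with `n` points, without shift. -/
def latticePoint (n : ℕ) (z : Fin d → ℤ) (k : ℕ) : UnitAddTorus (Fin d) :=
  fun j => (((z j : ℝ) * (k : ℝ) / (n : ℝ) : ℝ) : UnitAddCircle)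

theorem mFourier_latticePoint (n : ℕ) (z : Fin d → ℤ) (k : ℕ) (h : Fin d → ℤ) :
    UnitAddTorus.mFourier h (latticePoint n z k) =
      Complex.exp (2 * Real.pi * Complex.I * ((dotProduct h z : ℤ) / n)) ^ k := by
  simp only [UnitAddTorus.mFourier, ContinuousMap.coe_mk, latticePoint, fourier_coe_apply]
  rw [← Complex.exp_sum, ← Complex.exp_nat_mul]
  congr 1
  simp only [dotProduct]
  push_cast
  rw [sum_div, mul_sum, mul_sum]
  refine sum_congr rfl fun j _ => ?_
  ring

/-- The lattice rule is exact for the Fourier modes outside the dual lattice. -/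
theorem sum_mFourier_latticePoint {n : ℕ} (hn : 0 < n) (z h : Fin d → ℤ) :
    1 / (n : ℂ) * ∑ k ∈ range n, UnitAddTorus.mFourier h (latticePoint n z k) =
      if (n : ℤ) ∣ dotProduct h z then 1 else 0 := by
  have hn0 : (n : ℂ) ≠ 0 := by exact_mod_cast hn.ne'
  have hpi : (2 * Real.pi * Complex.I : ℂ) ≠ 0 := Complex.two_pi_I_ne_zero
  simp_rw [mFourier_latticePoint]
  set ξ := Complex.exp (2 * Real.pi * Complex.I * ((dotProduct h z : ℤ) / n)) with hξ
  have hone : ξ = 1 ↔ (n : ℤ) ∣ dotProduct h z := by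
    rw [hξ, Complex.exp_eq_one_iff]
    constructor
    · rintro ⟨m, hm⟩
      refine ⟨m, ?_⟩
      rw [mul_comm (m : ℂ)] at hm
      have h1 := mul_left_cancel₀ hpi hm
      rw [div_eq_iff hn0] at h1
      have h2 : dotProduct h z = m * n := by exact_mod_cast h1
      rw [h2, mul_comm]
    · rintro ⟨m, hm⟩
      refine ⟨m, ?_⟩
      rw [hm]
      push_cast
      field_simp
  split_ifs with hd
  · rw [hone.2 hd]; simp [hn0]
  · have hne : ξ ≠ 1 := fun hc => hd (hone.1 hc)
    have hpow : ξ ^ n = 1 := by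
      rw [hξ, ← Complex.exp_nat_mul, Complex.exp_eq_one_iff]
      refine ⟨dotProduct h z, ?_⟩
      field_simp
    rw [geom_sum_eq hne, hpow]; simp

theorem integral_mFourier_neg (h : Fin d → ℤ) :
    ∫ t, UnitAddTorus.mFourier (-h) t ∂torusMeasure d = if h = 0 then 1 else 0 := by
  split_ifs with h0
  · subst h0; simp [UnitAddTorus.mFourier_zero]
  · obtain ⟨j, hj⟩ := Function.ne_iff.1 h0
    have hj' : h j ≠ 0 := hj
    -- translating by half a period in the coordinate `j` changes the sign
    set a : UnitAddTorus (Fin d) := Pi.single j (((1 : ℝ) / 2 / h j : ℝ) : UnitAddCircle) with ha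
    have hm : UnitAddTorus.mFourier h a = -1 := by
      simp only [UnitAddTorus.mFourier, ContinuousMap.coe_mk]
      rw [prod_eq_single j]
      · have := fourier_add_half_inv_index (T := (1 : ℝ)) hj' zero_lt_one 0
        rw [zero_add] at this
        rw [ha, Pi.single_eq_same, this, fourier_eval_zero]
      · intro i _ hi
        rw [ha, Pi.single_eq_of_ne hi, fourier_eval_zero]
      · simp
    have ht := mFourierCoeff_translate (fun _ => (1 : ℂ)) a h
    rw [hm] at ht
    have h1 : UnitAddTorus.mFourierCoeff (fun _ : UnitAddTorus (Fin d) => (1 : ℂ)) h = 0 := by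
      have h2 : (2 : ℂ) * UnitAddTorus.mFourierCoeff (fun _ : UnitAddTorus (Fin d) => (1 : ℂ)) h = 0 := by
        linear_combination ht
      simpa using h2
    have h3 : ∫ t, UnitAddTorus.mFourier (-h) t • (1 : ℂ) ∂torusMeasure d = 0 := h1
    simpa using h3

theorem integrable_mFourier_smul {f : UnitAddTorus (Fin d) → ℂ} (hf : Integrable f (torusMeasure d))
    (h : Fin d → ℤ) : Integrable (fun t => UnitAddTorus.mFourier h t • f t) (torusMeasure d) := by
  refine hf.bdd_smul (C := 1) (UnitAddTorus.mFourier h).continuous.aestronglyMeasurable ?_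
  refine ae_of_all _ fun t => ?_
  exact ((UnitAddTorus.mFourier h).norm_coe_le_norm t).trans UnitAddTorus.mFourier_norm.le

theorem mFourierCoeff_zero_eq_torusIntegral (f : UnitAddTorus (Fin d) → ℂ) :
    UnitAddTorus.mFourierCoeff f 0 = torusIntegral f := by
  change ∫ t, UnitAddTorus.mFourier (-0) t • f t ∂torusMeasure d = _
  simp [UnitAddTorus.mFourier_zero, torusIntegral]

/-- The error of the shifted rule, as a function of the shift, has the Fourier coefficients of `f`
at the nonzero elements of the dual lattice, and no others. -/
theorem mFourierCoeff_error {n : ℕ} (hn : 0 < n) (z : Fin d → ℤ) {f : UnitAddTorus (Fin d) → ℂ}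
    (hf : MemLp f 2 (torusMeasure d)) (h : Fin d → ℤ) :
    UnitAddTorus.mFourierCoeff (fun Δ => shiftedLatticeRule n z Δ f - torusIntegral f) h =
      if h ≠ 0 ∧ (n : ℤ) ∣ dotProduct h z then UnitAddTorus.mFourierCoeff f h else 0 := by
  have htr : ∀ k, Integrable (fun t => f (latticePoint n z k + t)) (torusMeasure d) := fun k =>
    (memLp_translate hf _).integrable (by norm_num)
  have hterm : ∀ k, Integrable (fun t => UnitAddTorus.mFourier (-h) t •
      f (latticePoint n z k + t)) (torusMeasure d) := fun k => integrable_mFourier_smul (htr k) _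
  have hconst : Integrable (fun t => UnitAddTorus.mFourier (-h) t • torusIntegral f)
    (torusMeasure d) := integrable_mFourier_smul (integrable_const _) _
  have e1 : ∀ t, UnitAddTorus.mFourier (-h) t • (shiftedLatticeRule n z t f - torusIntegral f) =
      1 / (n : ℂ) * ∑ k ∈ range n, UnitAddTorus.mFourier (-h) t • f (latticePoint n z k + t) -
        UnitAddTorus.mFourier (-h) t • torusIntegral f := by
    intro t
    have : shiftedLatticeRule n z t f =
      1 / (n : ℂ) * ∑ k ∈ range n, f (latticePoint n z k + t) := rfl
    rw [this, smul_sub, ← smul_sum]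
    simp only [smul_eq_mul]
    ring
  have e2 : UnitAddTorus.mFourierCoeff (fun Δ => shiftedLatticeRule n z Δ f - torusIntegral f) h =
      1 / (n : ℂ) * ∑ k ∈ range n,
        UnitAddTorus.mFourierCoeff (fun t => f (latticePoint n z k + t)) h -
      (if h = 0 then 1 else 0) * torusIntegral f := by
    change ∫ t, UnitAddTorus.mFourier (-h) t • (shiftedLatticeRule n z t f - torusIntegral f)
      ∂torusMeasure d = 1 / (n : ℂ) * ∑ k ∈ range n, ∫ t, UnitAddTorus.mFourier (-h) t •
        f (latticePoint n z k + t) ∂torusMeasure d - _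
    simp_rw [e1]
    rw [integral_sub ((integrable_finsetSum _ fun k _ => hterm k).const_mul _) hconst,
      integral_const_mul, integral_finsetSum _ fun k _ => hterm k, integral_smul_const,
      integral_mFourier_neg, smul_eq_mul]
  rw [e2]
  simp_rw [mFourierCoeff_translate]
  rw [← sum_mul, ← mul_assoc, sum_mFourier_latticePoint hn]
  by_cases h0 : h = 0
  · subst h0
    simp [mFourierCoeff_zero_eq_torusIntegral]
  · by_cases hd : (n : ℤ) ∣ dotProduct h z <;> simp [h0, hd]

theorem lintegral_error_eq {n : ℕ} (hn : 0 < n) (z : Fin d → ℤ) {f : UnitAddTorus (Fin d) → ℂ}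
    (hf : MemLp f 2 (torusMeasure d)) :
    ∫⁻ Δ, ‖shiftedLatticeRule n z Δ f - torusIntegral f‖ₑ ^ 2 ∂torusMeasure d =
      ∑' h : Fin d → ℤ, if h ≠ 0 ∧ (n : ℤ) ∣ dotProduct h z then
        ‖UnitAddTorus.mFourierCoeff f h‖ₑ ^ 2 else 0 := by
  have hg : MemLp (fun Δ => shiftedLatticeRule n z Δ f - torusIntegral f) 2 (torusMeasure d) := by
    have h1 : MemLp (fun Δ => 1 / (n : ℂ) * ∑ k ∈ range n, f (latticePoint n z k + Δ)) 2
        (torusMeasure d) := by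
      refine MemLp.const_mul ?_ _
      exact memLp_finsetSum _ fun k _ => memLp_translate hf _
    exact h1.sub (memLp_const _)
  rw [lintegral_enorm_sq_eq_tsum hg]
  refine tsum_congr fun h => ?_
  rw [mFourierCoeff_error hn z hf]
  split_ifs <;> simp

/-- The worst-case error is governed by the worst frequency. -/
theorem rmsError_le_of_forall (hγ : ∀ u, 0 < γ u) {n : ℕ} (hne : (primeRange n).Nonempty)
    (z : Fin d → ℤ) {b : ℝ} (hb : 0 ≤ b)
    (h : ∀ h : Fin d → ℤ, h ≠ 0 → 1 ≤ dualCount (primeRange n) z h →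
      (dualCount (primeRange n) z h : ℝ) ≤ #(primeRange n) * (b ^ 2 * korobovWeight α γ h ^ 2)) :
    rmsError α γ n z ≤ ENNReal.ofReal b := by
  set P := primeRange n with hP
  have hP0 : (0 : ℝ) < #P := by exact_mod_cast hne.card_pos
  have hPpos : ∀ p ∈ P, 0 < p := fun p hp => (mem_Icc.1 (mem_filter.1 hp).1).1
  refine iSup₂_le fun f hf => ?_
  obtain ⟨⟨hf2, _⟩, hf1⟩ := hf
  have hnorm : ∑' h : Fin d → ℤ, ‖UnitAddTorus.mFourierCoeff f h‖ₑ ^ 2 *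
      ENNReal.ofReal (korobovWeight α γ h) ^ 2 ≤ 1 := by
    rw [korobovNorm] at hf1
    by_contra hcon
    exact absurd hf1 (not_le.2 (ENNReal.one_lt_rpow (not_le.1 hcon) (by norm_num)))
  have key : ∫⁻ ω, ‖randomPrimeRule z f ω - torusIntegral f‖ₑ ^ 2 ∂primeShiftMeasure d n ≤
      ENNReal.ofReal b ^ 2 := by
    calc ∫⁻ ω, ‖randomPrimeRule z f ω - torusIntegral f‖ₑ ^ 2 ∂primeShiftMeasure d n
        ≤ ∫⁻ p, ∫⁻ Δ, ‖shiftedLatticeRule p z Δ f - torusIntegral f‖ₑ ^ 2 ∂torusMeasure d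
          ∂ProbabilityTheory.uniformOn (P : Set ℕ) := lintegral_prod_le _
      _ = (#P : ℝ≥0∞)⁻¹ * ∑ p ∈ P,
          ∫⁻ Δ, ‖shiftedLatticeRule p z Δ f - torusIntegral f‖ₑ ^ 2 ∂torusMeasure d := by
          rw [ProbabilityTheory.uniformOn, ProbabilityTheory.cond, lintegral_smul_measure,
            Measure.count_apply_finset, lintegral_finset]
          simp
      _ = (#P : ℝ≥0∞)⁻¹ * ∑ p ∈ P, ∑' h : Fin d → ℤ,
          if h ≠ 0 ∧ (p : ℤ) ∣ dotProduct h z then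
            ‖UnitAddTorus.mFourierCoeff f h‖ₑ ^ 2 else 0 := by
          congr 1
          exact sum_congr rfl fun p hp => lintegral_error_eq (hPpos p hp) z hf2
      _ = ∑' h : Fin d → ℤ, (#P : ℝ≥0∞)⁻¹ * ∑ p ∈ P, if h ≠ 0 ∧ (p : ℤ) ∣ dotProduct h z then
            ‖UnitAddTorus.mFourierCoeff f h‖ₑ ^ 2 else 0 := by
          rw [← Summable.tsum_finsetSum fun _ _ => ENNReal.summable, ENNReal.tsum_mul_left]
      _ ≤ ∑' h : Fin d → ℤ, ENNReal.ofReal b ^ 2 * (‖UnitAddTorus.mFourierCoeff f h‖ₑ ^ 2 *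
            ENNReal.ofReal (korobovWeight α γ h) ^ 2) := by
          refine ENNReal.tsum_le_tsum fun g => ?_
          by_cases hg : g = 0
          · simp [hg]
          · have e : ∑ p ∈ P, (if g ≠ 0 ∧ (p : ℤ) ∣ dotProduct g z then
                ‖UnitAddTorus.mFourierCoeff f g‖ₑ ^ 2 else 0) =
                (dualCount P z g : ℝ≥0∞) * ‖UnitAddTorus.mFourierCoeff f g‖ₑ ^ 2 := by
              simp only [hg, ne_eq, not_false_eq_true, true_and]
              rw [← sum_filter, sum_const, nsmul_eq_mul, dualCount]
            have hw := korobovWeight_pos hγ (α := α) g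
            have hc : (dualCount P z g : ℝ) ≤ #P * (b ^ 2 * korobovWeight α γ g ^ 2) := by
              rcases Nat.eq_zero_or_pos (dualCount P z g) with h0 | h0
              · rw [h0, Nat.cast_zero]; positivity
              · exact h g hg h0
            have hc' : (dualCount P z g : ℝ≥0∞) ≤ #P * (ENNReal.ofReal b ^ 2 *
                ENNReal.ofReal (korobovWeight α γ g) ^ 2) := by
              have := ENNReal.ofReal_le_ofReal hc
              rwa [ENNReal.ofReal_natCast, ENNReal.ofReal_mul hP0.le, ENNReal.ofReal_natCast,
                ENNReal.ofReal_mul (sq_nonneg b), ENNReal.ofReal_pow hb,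
                ENNReal.ofReal_pow hw.le] at this
            rw [e]
            calc (#P : ℝ≥0∞)⁻¹ * (dualCount P z g * ‖UnitAddTorus.mFourierCoeff f g‖ₑ ^ 2)
                ≤ (#P : ℝ≥0∞)⁻¹ * ((#P * (ENNReal.ofReal b ^ 2 *
                  ENNReal.ofReal (korobovWeight α γ g) ^ 2)) *
                  ‖UnitAddTorus.mFourierCoeff f g‖ₑ ^ 2) := by gcongr
              _ = ((#P : ℝ≥0∞)⁻¹ * #P) * (ENNReal.ofReal b ^ 2 *
                  (‖UnitAddTorus.mFourierCoeff f g‖ₑ ^ 2 *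
                  ENNReal.ofReal (korobovWeight α γ g) ^ 2)) := by ring
              _ = _ := by
                  rw [ENNReal.inv_mul_cancel (by simpa using hne.ne_empty) (by simp), one_mul]
      _ ≤ ENNReal.ofReal b ^ 2 * 1 := by rw [ENNReal.tsum_mul_left]; gcongr
      _ = ENNReal.ofReal b ^ 2 := mul_one _
  calc (∫⁻ ω, ‖randomPrimeRule z f ω - torusIntegral f‖ₑ ^ 2 ∂primeShiftMeasure d n) ^ (1 / 2 : ℝ)
      ≤ (ENNReal.ofReal b ^ 2) ^ (1 / 2 : ℝ) := by gcongr
    _ = ENNReal.ofReal b := by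
        rw [← ENNReal.rpow_natCast, ← ENNReal.rpow_mul]; norm_num

/-! ### The error bounds -/

/-- If `4 R(h)` dominates both `n` and `(k(h) log (r + 1) / (θ C₃ r)) ^ r`, the error bound holds.
The factor `θ` relaxes the requirement `C n / log n ≤ |P|` on the number of primes; since
`1 / r ≤ 2 lam`, the hypothesis `n ≤ 4 R(h)` allows the exponent `1 / r` of `4 R(h) / n` to be raised
to `2 lam`. -/
theorem rmsError_le_errorBound (hα : 0 < α) (hγ : ∀ u, 0 < γ u) {n : ℕ} (hn : 2 ≤ n)
    (hne : (primeRange n).Nonempty) {z : Fin d → ℤ} {C θ : ℝ} (hC : 0 < C) (hθ : 0 < θ)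
    (hP : θ * C * n ≤ #(primeRange n) * Real.log n)
    (hz : ∀ h : Fin d → ℤ, h ≠ 0 → 1 ≤ dualCount (primeRange n) z h →
      n ≤ 4 * (korobovIndex α γ h : ℝ) ∧ ∀ r : ℕ, 1 ≤ r →
        (dualCount (primeRange n) z h * Real.log (r + 1) / (θ * 0.792 * r)) ^ r ≤
          4 * (korobovIndex α γ h : ℝ))
    {lam : ℝ} {r : ℕ} (hlam : 0 < lam) (hlα : lam < α) (hr : 1 / (2 * lam) ≤ r) {m : ℝ}
    (hm : muQuantity d α γ lam ≤ m) :
    rmsError α γ n z ≤ ENNReal.ofReal (errorBound C n lam r m) := by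
  have hr0 : (0 : ℝ) < r := lt_of_lt_of_le (by positivity) hr
  have hr1 : 1 ≤ r := by exact_mod_cast hr0
  have hn0 : (0 : ℝ) < n := by positivity
  have hn1 : (1 : ℝ) < n := by exact_mod_cast hn
  have hlog : 0 < Real.log n := Real.log_pos hn1
  set L := Real.log (r + 1) with hL
  have hL0 : 0 < L := Real.log_pos (by linarith)
  have hmu : 0 ≤ muQuantity d α γ lam :=
    tsum_nonneg fun h => Real.rpow_nonneg (korobovWeight_pos hγ _).le _
  have hm0 : 0 ≤ m := hmu.trans hm
  refine rmsError_le_of_forall hγ hne z (by unfold errorBound; positivity) fun h h0 hk => ?_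
  obtain ⟨hnR, hkr⟩ := hz h h0 hk
  set k := dualCount (primeRange n) z h
  set R : ℝ := ((korobovIndex α γ h : ℕ) : ℝ)
  set w := korobovWeight α γ h
  have hw0 : 0 < w := korobovWeight_pos hγ h
  have hR0 : 0 < 4 * R := hn0.trans_le hnR
  have hRm : (4 * R) ^ (2 * lam) ≤ (4 * m) ^ (2 * lam) * w ^ 2 := by
    have h1 : R ≤ m * w ^ (1 / lam) := by
      have h2 := (korobovIndex_mul_le hα hγ hlam hlα h).trans hm
      rw [neg_div, Real.rpow_neg hw0.le, ← div_eq_mul_inv, div_le_iff₀ (by positivity)] at h2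
      exact h2
    have h3 : w ^ 2 = (w ^ (1 / lam)) ^ (2 * lam) := by
      rw [← Real.rpow_mul hw0.le, show 1 / lam * (2 * lam) = 2 by field_simp]
      norm_num
    rw [h3, ← Real.mul_rpow (by positivity) (by positivity)]
    exact Real.rpow_le_rpow hR0.le (by linarith) (by positivity)
  have hkX : k * L / (θ * 0.792 * r) ≤ (4 * R) ^ (1 / r : ℝ) := by
    have h1 := hkr r hr1
    rw [← Real.rpow_le_rpow_iff (by positivity) (by positivity) hr0, ← Real.rpow_mul hR0.le,
      one_div_mul_cancel hr0.ne', Real.rpow_one, Real.rpow_natCast]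
    exact h1
  have hX : (4 * R) ^ (1 / r : ℝ) ≤ (n : ℝ) ^ (1 / r : ℝ) * (4 * R / n) ^ (2 * lam) := by
    have h1 : (4 * R / n) ^ (1 / r : ℝ) ≤ (4 * R / n) ^ (2 * lam) := by
      refine Real.rpow_le_rpow_of_exponent_le ((one_le_div hn0).2 hnR) ?_
      rw [div_le_iff₀ (by positivity)] at hr ⊢
      linarith
    calc (4 * R) ^ (1 / r : ℝ) = (n : ℝ) ^ (1 / r : ℝ) * (4 * R / n) ^ (1 / r : ℝ) := by
          rw [← Real.mul_rpow hn0.le (by positivity), mul_div_cancel₀ _ hn0.ne']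
      _ ≤ _ := by gcongr
  have hb2 : errorBound C n lam r m ^ 2 = (n : ℝ) ^ (1 / r : ℝ) / n / (n : ℝ) ^ (2 * lam) *
      (0.792 * r * Real.log n / (C * L)) * (4 * m) ^ (2 * lam) := by
    rw [errorBound, ← hL, mul_pow, mul_pow, ← Real.rpow_natCast ((4 * m) ^ lam),
      ← Real.rpow_mul (by positivity), ← Real.rpow_natCast (_ ^ (1 / 2 : ℝ)),
      ← Real.rpow_mul (by positivity), div_pow, ← Real.rpow_natCast ((n : ℝ) ^ _),
      ← Real.rpow_mul hn0.le]
    have e1 : (n : ℝ) ^ ((lam + ((r : ℝ) - 1) / (2 * r)) * (2 : ℕ)) =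
        n * (n : ℝ) ^ (2 * lam) / (n : ℝ) ^ (1 / r : ℝ) := by
      rw [show (lam + ((r : ℝ) - 1) / (2 * r)) * (2 : ℕ) = 1 + 2 * lam - 1 / r by
        push_cast; field_simp; ring, Real.rpow_sub hn0, Real.rpow_add hn0, Real.rpow_one]
    rw [e1]
    have e2 : lam * ((2 : ℕ) : ℝ) = 2 * lam := by push_cast; ring
    rw [e2, show (1 / 2 : ℝ) * (2 : ℕ) = 1 by norm_num, Real.rpow_one]
    field_simp
  rw [hb2]
  have hPn : θ ≤ #(primeRange n) * Real.log n / (C * n) := by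
    rw [le_div_iff₀ (by positivity)]; linarith
  calc (k : ℝ) = θ * (0.792 * r / L) * (k * L / (θ * 0.792 * r)) := by field_simp
    _ ≤ θ * (0.792 * r / L) * ((n : ℝ) ^ (1 / r : ℝ) * (4 * R / n) ^ (2 * lam)) := by
        gcongr; exact hkX.trans hX
    _ ≤ (#(primeRange n) * Real.log n / (C * n)) * (0.792 * r / L) *
        ((n : ℝ) ^ (1 / r : ℝ) * (4 * R / n) ^ (2 * lam)) := by gcongr
    _ = #(primeRange n) * ((n : ℝ) ^ (1 / r : ℝ) / n / (n : ℝ) ^ (2 * lam) *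
      (0.792 * r * Real.log n / (C * L))) * (4 * R) ^ (2 * lam) := by
        rw [Real.div_rpow hR0.le hn0.le]; field_simp
    _ ≤ #(primeRange n) * ((n : ℝ) ^ (1 / r : ℝ) / n / (n : ℝ) ^ (2 * lam) *
      (0.792 * r * Real.log n / (C * L))) * ((4 * m) ^ (2 * lam) * w ^ 2) := by gcongr
    _ = _ := by ring

/-- The condition on `H k = a y ^ k k!` in the choice of the generating vector: only the terms with
`k ≥ k₀` can be present, and they are dominated by a geometric series. -/
theorem sum_geometric_factorial_lt {a y x x₀ n : ℝ} (ha : 0 < a) (hy : 0 < y) (hx : 0 ≤ x)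
    (hxx : x ≤ x₀) (k₀ N : ℕ) (hq : y * x₀ < 1)
    (hk₀ : ∀ k : ℕ, 1 ≤ k → k < k₀ → a * y ^ k * k.factorial ≤ n)
    (h8 : a * ((y * x₀) ^ k₀ / (1 - y * x₀)) < 8) :
    ∑ k ∈ range N, (if 1 ≤ k ∧ n < a * y ^ k * k.factorial then
      a * y ^ k * k.factorial * x ^ k / k.factorial else 0) < 8 := by
  have hq0 : 0 ≤ y * x₀ := mul_nonneg hy.le (hx.trans hxx)
  refine lt_of_le_of_lt ?_ h8
  calc _ ≤ ∑ k ∈ range N, if k ∈ Ico k₀ N then a * (y * x₀) ^ k else 0 := by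
        refine sum_le_sum fun k hk => ?_
        by_cases hc : 1 ≤ k ∧ n < a * y ^ k * k.factorial
        · have hkk : k₀ ≤ k := by
            by_contra hlt
            exact absurd (hk₀ k hc.1 (not_le.1 hlt)) (not_le.2 hc.2)
          rw [if_pos hc, if_pos (mem_Ico.2 ⟨hkk, mem_range.1 hk⟩), mul_pow]
          have : (0 : ℝ) < k.factorial := by positivity
          rw [mul_right_comm, mul_div_assoc, div_self this.ne', mul_one, mul_assoc]
          gcongr
        · rw [if_neg hc]
          split_ifs <;> positivity
    _ = a * ∑ k ∈ Ico k₀ N, (y * x₀) ^ k := by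
        rw [← sum_filter, mul_sum]
        refine sum_congr ?_ fun _ _ => rfl
        ext k; simp
    _ ≤ a * ((y * x₀) ^ k₀ / (1 - y * x₀)) := by
        gcongr
        exact geom_sum_Ico_le_of_lt_one hq0 hq

theorem primeRange_mem {n p : ℕ} (hp : p ∈ primeRange n) : p.Prime ∧ n < 2 * p := by
  have h := (mem_filter.1 hp).2
  refine ⟨h.1, ?_⟩
  have h2 : (n : ℝ) < 2 * p := by linarith [h.2]
  exact_mod_cast h2

/-- The generating vectors.  The first property serves arbitrary constants `c₁`, `c₂`, since
`n ≥ e ^ (6 c₂)` implies `6 |P| ≤ n`.  For `n ≥ 37` the stronger property with `0.82 * 0.792` instead of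
`0.792` compensates for the fact that `(n/2, n]` may contain fewer than `0.4 n / log n` primes
(as for `n = 40`). -/
theorem exists_vector (hα : 0 < α) (hγ : ∀ u, 0 < γ u) (d n : ℕ) :
    ∃ z : Fin d → ℤ, (∀ j, 0 ≤ z j ∧ z j < ((∏ p ∈ primeRange n, p : ℕ) : ℤ)) ∧
      (6 * #(primeRange n) ≤ n → ∀ h : Fin d → ℤ, h ≠ 0 → 1 ≤ dualCount (primeRange n) z h →
        n ≤ 4 * (korobovIndex α γ h : ℝ) ∧ ∀ r : ℕ, 1 ≤ r →
        (dualCount (primeRange n) z h * Real.log (r + 1) / (1 * 0.792 * r)) ^ r ≤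
          4 * (korobovIndex α γ h : ℝ)) ∧
      (37 ≤ n → ∀ h : Fin d → ℤ, h ≠ 0 → 1 ≤ dualCount (primeRange n) z h →
        n ≤ 4 * (korobovIndex α γ h : ℝ) ∧ ∀ r : ℕ, 1 ≤ r →
        (dualCount (primeRange n) z h * Real.log (r + 1) / (0.82 * 0.792 * r)) ^ r ≤
          4 * (korobovIndex α γ h : ℝ)) := by
  rcases Nat.eq_zero_or_pos n with rfl | hn
  · refine ⟨0, fun j => ⟨le_rfl, ?_⟩, fun _ h _ hk => ?_, by omega⟩
    · simp [primeRange]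
    · simp [primeRange, dualCount] at hk
  have hn0 : (0 : ℝ) < n := by exact_mod_cast hn
  rcases Nat.lt_or_ge n 37 with h37 | h37
  · by_cases h6 : 6 * #(primeRange n) ≤ n
    · have hx : (14 * #(primeRange n) / (3 * n) : ℝ) ≤ 7 / 9 := by
        have : (6 * #(primeRange n) : ℝ) ≤ n := by exact_mod_cast h6
        rw [div_le_div_iff₀ (by positivity) (by norm_num)]; linarith
      obtain ⟨z, hz, hz'⟩ := exists_generatingVector (d := d) hα hγ hn
        (fun p hp => primeRange_mem hp) (H := fun k => 2.75 * 0.92 ^ k * k.factorial)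
        (sum_geometric_factorial_lt (by norm_num) (by norm_num) (by positivity) hx 1 _ (by norm_num)
          (by intro k h1 h2; omega) (by norm_num))
      refine ⟨z, hz, fun _ h h0 hk => ⟨(hz' h h0 hk).1, fun r hr => ?_⟩, by omega⟩
      rw [one_mul]
      exact (pow_log_le_small hk hr).trans (hz' h h0 hk).2
    -- neither of the two properties is claimed in this case
    · refine ⟨0, fun j => ⟨le_rfl, ?_⟩, fun h => absurd h h6, by omega⟩
      have : 0 < ∏ p ∈ primeRange n, p := prod_pos fun p hp => (primeRange_mem hp).1.pos
      change (0 : ℤ) < _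
      exact_mod_cast this
  -- here `H k ≤ 37 ≤ n` for `k < 4`, so that these terms are absent from the sum
  · have hx : (14 * #(primeRange n) / (3 * n) : ℝ) ≤ 2 / 3 := by
      have : (7 * #(primeRange n) : ℝ) ≤ n := by exact_mod_cast (primeRange_bounds h37).1
      rw [div_le_div_iff₀ (by positivity) (by norm_num)]; linarith
    have h37' : (37 : ℝ) ≤ n := by exact_mod_cast h37
    obtain ⟨z, hz, hz'⟩ := exists_generatingVector (d := d) hα hγ hn
      (fun p hp => primeRange_mem hp) (H := fun k => 2.31 * 1.23 ^ k * k.factorial)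
      (sum_geometric_factorial_lt (by norm_num) (by norm_num) (by positivity) hx 4 _ (by norm_num)
        (by
          intro k h1 h2
          refine le_trans ?_ h37'
          interval_cases k <;> norm_num [Nat.factorial]) (by norm_num))
    have hlarge : ∀ h : Fin d → ℤ, h ≠ 0 → 1 ≤ dualCount (primeRange n) z h →
        n ≤ 4 * (korobovIndex α γ h : ℝ) ∧ ∀ r : ℕ, 1 ≤ r →
        (dualCount (primeRange n) z h * Real.log (r + 1) / (0.82 * 0.792 * r)) ^ r ≤
          4 * (korobovIndex α γ h : ℝ) := fun h h0 hk =>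
      ⟨(hz' h h0 hk).1, fun r hr => (pow_log_le_large hk hr).trans
        (max_le (h37'.trans (hz' h h0 hk).1) (hz' h h0 hk).2)⟩
    refine ⟨z, hz, fun _ h h0 hk => ⟨(hz' h h0 hk).1, fun r hr => ?_⟩, fun _ => hlarge⟩
    refine le_trans ?_ ((hlarge h h0 hk).2 r hr)
    have hr0 : (0 : ℝ) < r := by exact_mod_cast hr
    have hL0 : 0 ≤ Real.log (r + 1 : ℝ) := Real.log_nonneg (by linarith)
    gcongr
    norm_num

/-- For large `r` the bound has an order of convergence arbitrarily close to `lam + 1/2`. -/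
theorem exists_errorBound_le_rpow {C lam m ε : ℝ} (hC : 0 < C) (hlam : 0 < lam) (hm : 0 ≤ m)
    (hε : 0 < ε) : ∃ (r : ℕ) (K : ℝ), 1 / (2 * lam) ≤ r ∧ ∀ n : ℕ, 1 ≤ n →
      errorBound C n lam r m ≤ K * (n : ℝ) ^ (-lam - 1 / 2 + ε) := by
  -- `1 / r ≤ ε` gives up `ε / 2` in the exponent, and `log n ≤ n ^ ε / ε` the other half
  obtain ⟨r, hr⟩ := exists_nat_ge (max (1 / (2 * lam)) (1 / ε))
  have hr1 : 1 / (2 * lam) ≤ r := (le_max_left _ _).trans hr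
  have hr2 : 1 / ε ≤ r := (le_max_right _ _).trans hr
  have hr0 : (0 : ℝ) < r := lt_of_lt_of_le (by positivity) hr1
  have hL : 0 < Real.log (r + 1 : ℝ) := Real.log_pos (by linarith)
  refine ⟨r, (0.792 * r / (C * Real.log (r + 1)) / ε) ^ (1 / 2 : ℝ) * (4 * m) ^ lam, hr1,
    fun n hn => ?_⟩
  have hn1 : (1 : ℝ) ≤ n := by exact_mod_cast hn
  have hn0 : (0 : ℝ) < n := by linarith
  have hlog := Real.log_le_rpow_div hn0.le hε
  have h1 : (0.792 * r * Real.log n / (C * Real.log (r + 1))) ^ (1 / 2 : ℝ) ≤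
      (0.792 * r / (C * Real.log (r + 1)) / ε) ^ (1 / 2 : ℝ) * (n : ℝ) ^ (ε / 2) := by
    rw [show ε / 2 = ε * (1 / 2) by ring, Real.rpow_mul hn0.le,
      ← Real.mul_rpow (by positivity) (by positivity)]
    have : 0 ≤ Real.log n := Real.log_nonneg hn1
    refine Real.rpow_le_rpow (by positivity) ?_ (by norm_num)
    calc 0.792 * r * Real.log n / (C * Real.log (r + 1))
        ≤ 0.792 * r * (n ^ ε / ε) / (C * Real.log (r + 1)) := by gcongr
      _ = _ := by ring
  have h2 : 1 / (n : ℝ) ^ (lam + ((r : ℝ) - 1) / (2 * r)) * (n : ℝ) ^ (ε / 2) ≤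
      (n : ℝ) ^ (-lam - 1 / 2 + ε) := by
    rw [one_div, ← Real.rpow_neg hn0.le, ← Real.rpow_add hn0]
    refine Real.rpow_le_rpow_of_exponent_le hn1 ?_
    have h3 : ((r : ℝ) - 1) / (2 * r) = 1 / 2 - 1 / r / 2 := by field_simp
    have h4 : 1 / (r : ℝ) ≤ ε := by
      rw [div_le_iff₀ hr0]
      rw [div_le_iff₀ hε] at hr2
      linarith
    rw [h3]; linarith
  unfold errorBound
  calc _ ≤ 1 / (n : ℝ) ^ (lam + ((r : ℝ) - 1) / (2 * r)) *
        ((0.792 * r / (C * Real.log (r + 1)) / ε) ^ (1 / 2 : ℝ) * (n : ℝ) ^ (ε / 2)) *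
          (4 * m) ^ lam := by gcongr
    _ = (0.792 * r / (C * Real.log (r + 1)) / ε) ^ (1 / 2 : ℝ) * (4 * m) ^ lam *
        (1 / (n : ℝ) ^ (lam + ((r : ℝ) - 1) / (2 * r)) * (n : ℝ) ^ (ε / 2)) := by ring
    _ ≤ _ := by gcongr

theorem thirty_six_lt_exp : (36 : ℝ) < Real.exp (6 * 0.599) := by
  have h1 : Real.exp (6 * 0.599 : ℝ) = Real.exp 1 ^ 3 * Real.exp 0.594 := by
    rw [← Real.exp_nat_mul, ← Real.exp_add]; norm_num
  have h2 : (1.81 : ℝ) ≤ Real.exp 0.594 := by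
    refine le_trans ?_ (Real.sum_le_exp_of_nonneg (by norm_num) 5)
    norm_num [sum_range_succ, Nat.factorial]
  have h3 : (2.718 : ℝ) ≤ Real.exp 1 := by linarith [Real.exp_one_gt_d9]
  rw [h1]
  calc (36 : ℝ) < 2.718 ^ 3 * 1.81 := by norm_num
    _ ≤ _ := by gcongr

end RandomLattice

end

theorem mainTheorem1 :
    ∃ C₁ C₂ : ℝ, 0.4 < C₁ ∧ C₁ < 0.5 ∧ 0.5 < C₂ ∧ C₂ < 0.6 ∧ 34 < Real.exp (6 * C₂) ∧
      ∀ (α : ℝ) (γ : Finset ℕ → ℝ), 0 < α → (∀ u, 0 < γ u) →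
        ∃ z : (d : ℕ) → ℕ → Fin d → ℤ,
          -- the generating vector has entries in {0, …, N - 1}, N the product of the primes
          (∀ d n : ℕ, ∀ j : Fin d, 0 ≤ z d n j ∧
            z d n j < ((∏ p ∈ RandomLattice.primeRange n, p : ℕ) : ℤ)) ∧
          -- the bounds with arbitrary constants for the number of primes in (n/2, n]
          (∀ (c₁ c₂ : ℝ) (d n : ℕ), 0 < c₁ → 0 < c₂ → 1 ≤ d →
            c₁ * (n / Real.log n) ≤ ((RandomLattice.primeRange n).card : ℝ) →
            ((RandomLattice.primeRange n).card : ℝ) ≤ c₂ * (n / Real.log n) →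
            Real.exp (6 * c₂) ≤ n →
            ∀ (lam : ℝ) (r : ℕ), 0 < lam → lam < α → 1 / (2 * lam) ≤ r →
              RandomLattice.rmsError α γ n (z d n) ≤ ENNReal.ofReal
                (RandomLattice.errorBound c₁ n lam r (RandomLattice.muQuantity d α γ lam)) ∧
              (Summable (RandomLattice.weightTerm α γ lam) →
                RandomLattice.rmsError α γ n (z d n) ≤ ENNReal.ofReal
                  (RandomLattice.errorBound c₁ n lam r
                    (∑' u, RandomLattice.weightTerm α γ lam u)))) ∧
          -- the bounds with the numerical constants
          (∀ d n : ℕ, 1 ≤ d → Real.exp (6 * C₂) ≤ n →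
            ∀ (lam : ℝ) (r : ℕ), 0 < lam → lam < α → 1 / (2 * lam) ≤ r →
              RandomLattice.rmsError α γ n (z d n) ≤ ENNReal.ofReal
                (RandomLattice.errorBound C₁ n lam r (RandomLattice.muQuantity d α γ lam)) ∧
              (Summable (RandomLattice.weightTerm α γ lam) →
                RandomLattice.rmsError α γ n (z d n) ≤ ENNReal.ofReal
                  (RandomLattice.errorBound C₁ n lam r
                    (∑' u, RandomLattice.weightTerm α γ lam u)))) ∧
          -- the rate of convergence
          (∀ (d : ℕ) (ε : ℝ), 1 ≤ d → 0 < ε → ∃ K : ℝ, ∀ n : ℕ, Real.exp (6 * C₂) ≤ n →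
            RandomLattice.rmsError α γ n (z d n) ≤
              ENNReal.ofReal (K * (n : ℝ) ^ (-α - 1 / 2 + ε))) ∧
          -- the rate with a constant that does not depend on the dimension
          (∀ lam ε : ℝ, 0 < lam → lam < α → Summable (RandomLattice.weightTerm α γ lam) →
            0 < ε → ∃ K : ℝ, ∀ d n : ℕ, 1 ≤ d → Real.exp (6 * C₂) ≤ n →
              RandomLattice.rmsError α γ n (z d n) ≤
                ENNReal.ofReal (K * (n : ℝ) ^ (-lam - 1 / 2 + ε))) := by
  -- `e ^ (6 C₂)` exceeds `36`, so that only `n ≥ 37` matter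
  have h37 : ∀ n : ℕ, Real.exp (6 * 0.599) ≤ n → 37 ≤ n := fun n hn => by
    have : (36 : ℝ) < n := RandomLattice.thirty_six_lt_exp.trans_le hn
    exact_mod_cast this
  refine ⟨0.4001, 0.599, by norm_num, by norm_num, by norm_num, by norm_num,
    by linarith [RandomLattice.thirty_six_lt_exp], fun α γ hα hγ => ?_⟩
  choose z hz hsmall hlarge using RandomLattice.exists_vector hα hγ
  have hpart2 : ∀ d n : ℕ, Real.exp (6 * 0.599) ≤ n → ∀ (lam : ℝ) (r : ℕ), 0 < lam → lam < α →
      1 / (2 * lam) ≤ r → ∀ m : ℝ, RandomLattice.muQuantity d α γ lam ≤ m →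
      RandomLattice.rmsError α γ n (z d n) ≤
        ENNReal.ofReal (RandomLattice.errorBound 0.4001 n lam r m) := by
    intro d n hn lam r hlam hlα hr m hm
    have hn' := h37 n hn
    have hb := (RandomLattice.primeRange_bounds hn').2
    have hn0 : (0 : ℝ) < n := by positivity
    have hne : (RandomLattice.primeRange n).Nonempty := by
      rw [Finset.nonempty_iff_ne_empty]
      intro he
      rw [he] at hb
      simp at hb
      linarith
    refine RandomLattice.rmsError_le_errorBound (θ := 0.82) hα hγ (by omega) hne (by norm_num)
      (by norm_num) ?_ (hlarge d n hn') hlam hlα hr hm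
    linarith
  have hmu : ∀ (d : ℕ) (lam : ℝ), 0 ≤ RandomLattice.muQuantity d α γ lam := fun d lam =>
    tsum_nonneg fun h => Real.rpow_nonneg (RandomLattice.korobovWeight_pos hγ _).le _
  refine ⟨z, hz, ?_, ?_, ?_, ?_⟩
  · intro c₁ c₂ d n hc₁ _ _ hP₁ hP₂ hn lam r hlam hlα hr
    have hn1 : (1 : ℝ) < n := lt_of_lt_of_le (Real.one_lt_exp_iff.2 (by positivity)) hn
    have hn2 : 2 ≤ n := by exact_mod_cast hn1
    have hn0 : (0 : ℝ) < n := by linarith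
    have hlog : 0 < Real.log n := Real.log_pos hn1
    have hlog6 : 6 * c₂ ≤ Real.log n := (Real.le_log_iff_exp_le hn0).2 hn
    have hne : (RandomLattice.primeRange n).Nonempty := by
      rw [← Finset.card_pos]
      have : (0 : ℝ) < (RandomLattice.primeRange n).card := lt_of_lt_of_le (by positivity) hP₁
      exact_mod_cast this
    rw [← mul_div_assoc, div_le_iff₀ hlog] at hP₁
    rw [← mul_div_assoc, le_div_iff₀ hlog] at hP₂
    have h6 : 6 * (RandomLattice.primeRange n).card ≤ n := by
      have h1 : (6 * (RandomLattice.primeRange n).card : ℝ) * Real.log n ≤ n * Real.log n := by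
        nlinarith
      exact_mod_cast le_of_mul_le_mul_right h1 hlog
    have key : ∀ m, RandomLattice.muQuantity d α γ lam ≤ m →
        RandomLattice.rmsError α γ n (z d n) ≤
          ENNReal.ofReal (RandomLattice.errorBound c₁ n lam r m) := fun m hm =>
      RandomLattice.rmsError_le_errorBound (θ := 1) hα hγ hn2 hne hc₁ one_pos (by linarith)
        (hsmall d n h6) hlam hlα hr hm
    exact ⟨key _ le_rfl, fun hs => key _ (RandomLattice.muQuantity_le_tsum hγ hlam hlα hs)⟩
  · intro d n _ hn lam r hlam hlα hr
    exact ⟨hpart2 d n hn lam r hlam hlα hr _ le_rfl, fun hs =>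
      hpart2 d n hn lam r hlam hlα hr _ (RandomLattice.muQuantity_le_tsum hγ hlam hlα hs)⟩
  · intro d ε _ hε
    -- the bound with `lam` slightly below `α`
    set lam := α - min (ε / 2) (α / 2) with hlamdef
    have h1 : min (ε / 2) (α / 2) ≤ ε / 2 := min_le_left _ _
    have h2 : min (ε / 2) (α / 2) ≤ α / 2 := min_le_right _ _
    have h3 : 0 < min (ε / 2) (α / 2) := lt_min (by linarith) (by linarith)
    have hlam : 0 < lam := by linarith
    obtain ⟨r, K, hr, hK⟩ := RandomLattice.exists_errorBound_le_rpow (C := 0.4001) (by norm_num)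
      hlam (hmu d lam) (half_pos hε)
    refine ⟨max K 0, fun n hn => (hpart2 d n hn lam r hlam (by linarith) hr _ le_rfl).trans
      (ENNReal.ofReal_le_ofReal ?_)⟩
    have hn' := h37 n hn
    have hn1 : (1 : ℝ) ≤ n := by exact_mod_cast (by omega : 1 ≤ n)
    refine (hK n (by omega)).trans ?_
    calc K * (n : ℝ) ^ (-lam - 1 / 2 + ε / 2) ≤ max K 0 * (n : ℝ) ^ (-lam - 1 / 2 + ε / 2) := by
          gcongr; exact le_max_left _ _
      _ ≤ max K 0 * (n : ℝ) ^ (-α - 1 / 2 + ε) := by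
          refine mul_le_mul_of_nonneg_left ?_ (le_max_right _ _)
          exact Real.rpow_le_rpow_of_exponent_le hn1 (by linarith)
  · intro lam ε hlam hlα hs hε
    have hM : 0 ≤ ∑' u, RandomLattice.weightTerm α γ lam u :=
      (hmu 1 lam).trans (RandomLattice.muQuantity_le_tsum hγ hlam hlα hs)
    obtain ⟨r, K, hr, hK⟩ := RandomLattice.exists_errorBound_le_rpow (C := 0.4001) (by norm_num)
      hlam hM hε
    refine ⟨K, fun d n _ hn => (hpart2 d n hn lam r hlam hlα hr _
      (RandomLattice.muQuantity_le_tsum hγ hlam hlα hs)).trans (ENNReal.ofReal_le_ofReal ?_)⟩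
    have hn' := h37 n hn
    exact hK n (by omega)
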